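/- **Setting.** Let $\Omega\subseteq\mathbb R^n$ be open, $T>0$, $Q=\Omega\times(0,T)$, $\Sigma=\partial\Omega\times(0,T)$, and $Y=\{y\in H^{2,1}(Q):\ y=0 \text{ on }\Sigma\}$, the boundary condition meaning $y(\cdot,t)\in H^1_0(\Omega)$ for a.e. $t$; elements of $Y$ are identified with their representatives in $C([0,T];L^2(\Omega))$. Let $\gamma\ge 0$, $f\in L^2(Q)$, $y_0\in H^1_0(\Omega)$, $b_0,\dots,b_m\in W^{2,\infty}(\Omega)$, $\check u_i<\hat u_i$ $(1\le i\le m)$, $c_j\in H^2(\Omega)\cap H^1_0(\Omega)$, $d_j\in\mathbb R$ $(1\le j\le q)$. Let $(\bar u,\bar y)\in L^2(0,T)^m\times Y$ be an admissible trajectory, i.e. (with $\bar u_0\equiv1$) $$\dot{\bar y}-\Delta\bar y+\gamma\bar y^3=f+\bar y\sum_{i=0}^m\bar u_ib_i\ \text{ in }Q,\qquad \bar y(\cdot,0)=y_0,$$ $\check u_i\le\bar u_i\le\hat u_i$ a.e., and $g_j(\bar y(\cdot,t)):=\int_\Omega c_j\,\bar y(\cdot,t)\,dx+d_j\le0$ on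 $[0,T]$. *Arcs.* Let $0=\tau_0<\dots<\tau_r=T$ be junction times such that on each arc $(\tau_k,\tau_{k+1})$, $0\le k\le r-1$, the set of active constraints is constant up to null sets: $B_k$ is the set of $i$ with $\bar u_i=\check u_i$ a.e. on the arc or $\bar u_i=\hat u_i$ a.e. on the arc, $C_k$ is the set of $j$ with $g_j(\bar y(\cdot,t))=0$ on the arc, and every other bound or state constraint is inactive at a.e. time of the arc. Let $M_{ij}(t)=\int_\Omega b_ic_j\,\bar y(\cdot,t)\,dx$, let $M_j(t)\in\mathbb R^m$ be the $j$-th column of $M(t)$, and let $\bar M_k(t)$ be the submatrix of $M(t)$ with rows $i\notin B_k$ and columns $j\in C_k$. Assume $|C_k|\le m-|B_k|$ for all $k$ and that there is $\alpha>0$ with $|\bar M_k(t)\mu|\ge\alpha|\mu|$ for all $k$, all $\mu\in\mathbb R^{|C_k|}$ and a.e. $t\in(\tau_k,\tau_{k+1})$. *Cones.* Put $Az=-\Delta z+3\gamma\bar y^2z-\sum_{i=0}^m\bar u_ib_iz$. The strict critical cone $C_s$ is the set of $(z,v)\in Y\times L^2(0,T)^m$ with $\dot z+Az=\sum_{i=1}^mv_ib_i\bar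 y$ in $Q$, $z(\cdot,0)=0$, $v_i=0$ a.e. on $\{\bar u_i\in\{\check u_i,\hat u_i\}\}$, and $\int_\Omega c_jz(\cdot,t)\,dx=0$ for all $t\in[0,T]$ with $g_j(\bar y(\cdot,t))=0$. Let $PC$ be the set of $(\zeta,w,w(T))$ with $\zeta\in Y$, $w(t)=\int_0^tv(s)\,ds$, $\zeta=z-\bar y\sum_{i=1}^mb_iw_i$ for some $(z,v)\in C_s$, and let $PC_2$ be the closure of $PC$ in $Y\times L^2(0,T)^m\times\mathbb R^m$. For $w\in L^2(0,T)^m$, let $\zeta[w]\in Y$ denote the solution of $$\dot\zeta+A\zeta=\sum_{i=1}^m B^1_iw_i\ \text{ in }Q,\quad \zeta(\cdot,0)=0,\qquad B^1_i=-fb_i+2\nabla\bar y\cdot\nabla b_i+\bar y\Delta b_i-2\gamma\bar y^3b_i .$$ *Matrices and one-sided values.* Let $\mathcal A^k(t)$ be the $(|B_k|+|C_k|)\times m$ matrix with rows $e_i^\top$ ($i\in B_k$) and $M_j(t)^\top$ ($j\in C_k$), for $t\in[\tau_k,\tau_{k+1}]$; let $(\mathcal B^kw)(t)$ have components $\frac1{\tau_{k+1}-\tau_k}\int_{\tau_k}^{\tau_{k+1}}w_i\,ds$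 ($i\in B_k$) and $-\int_\Omega c_j\zeta[w](\cdot,t)\,dx$ ($j\in C_k$). We write $w\in\operatorname{Ker}(\mathcal A-\mathcal B)$ if $\mathcal A^k(t)w(t)=(\mathcal B^kw)(t)$ for a.e. $t\in(\tau_k,\tau_{k+1})$ and all $k$. On the arc $(\tau_k,\tau_{k+1})$ decompose $w(t)=w_0(t)+\mathcal A^k(t)^\top\lambda^k(t)$ with $w_0(t)\in\operatorname{Ker}\mathcal A^k(t)$. When $\lambda^k$ has a continuous representative on the arc, $w(\tau_k^+)$ and $w(\tau_{k+1}^-)$ denote the one-sided limits of $\mathcal A^k(t)^\top\lambda^k(t)$, i.e. $w$ is evaluated at the ends of an arc modulo the kernel of $\mathcal A^k$. *Junction condition.* For $0\le k\le r-2$ and $c_{k+1}\in\mathbb R^m$ which is both a linear combination of the rows of $\mathcal A^{k}(\tau_{k+1})$ and a linear combination of the rows of $\mathcal A^{k+1}(\tau_{k+1})$, this is the condition that $w(\tau_{k+1}^\pm)$ exist and $$c_{k+1}\cdot\big(w(\tau_{k+1}^+)-w(\tau_{k+1}^-)\big)=0.\tag{J}$$ Let $PC_2'$ be the set of $(\zeta[w],w,h)$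 with $h\in\mathbb R^m$, $w\in\operatorname{Ker}(\mathcal A-\mathcal B)$, and (J) for all such $k$ and $c_{k+1}$. **Lemma.** For every $0\le k\le r-2$, every such $c_{k+1}$ and every $(\zeta,w,h)\in PC_2$, the one-sided values $w(\tau_{k+1}^\pm)$ exist and (J) holds. Consequently, $PC_2\subseteq PC_2'$. -/

import Mathlib

open MeasureTheory Set Filter Topology
open scoped ENNReal Matrix

noncomputable section

namespace BilinHeat

/-! ### Domains, `L²` spaces, weak derivatives -/

/-- The space `ℝⁿ` with its Euclidean norm. -/
abbrev Sp (n : ℕ) : Type := EuclideanSpace ℝ (Fin n)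

/-- Lebesgue measure on `Ω`. -/
abbrev measOmega {n : ℕ} (Ω : Set (Sp n)) : Measure (Sp n) := volume.restrict Ω

/-- Lebesgue measure on `(0,T)`. -/
abbrev measT (T : ℝ) : Measure ℝ := volume.restrict (Ioo 0 T)

/-- Lebesgue measure on `Q = Ω × (0,T)`. -/
abbrev measQ {n : ℕ} (Ω : Set (Sp n)) (T : ℝ) : Measure (Sp n × ℝ) :=
  (measOmega Ω).prod (measT T)

/-- `L²(Ω)`. -/
abbrev L2Omega {n : ℕ} (Ω : Set (Sp n)) : Type := Lp ℝ 2 (measOmega Ω)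

/-- `L²(0,T)`. -/
abbrev L2T (T : ℝ) : Type := Lp ℝ 2 (measT T)

/-- `L²(Q)`. -/
abbrev L2Q {n : ℕ} (Ω : Set (Sp n)) (T : ℝ) : Type := Lp ℝ 2 (measQ Ω T)

/-- The `i`-th vector of the standard basis of `ℝⁿ`. -/
abbrev dir {n : ℕ} (i : Fin n) : Sp n := EuclideanSpace.single i 1

/-- `φ` is a `C^∞` function with compact support contained in `U`. -/
def IsTest {V : Type*} [NormedAddCommGroup V] [NormedSpace ℝ V] (U : Set V) (φ : V → ℝ) : Prop :=
  ContDiff ℝ (⊤ : ℕ∞) φ ∧ HasCompactSupport φ ∧ tsupport φ ⊆ U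

/-- `g` is the distributional derivative of `f` in the direction `v` on the open set `U`;
`μ` is Lebesgue measure on `U`. -/
def HasWeakDeriv {V : Type*} [NormedAddCommGroup V] [NormedSpace ℝ V] [MeasurableSpace V]
    (U : Set V) (μ : Measure V) (v : V) (f g : V → ℝ) : Prop :=
  ∀ φ : V → ℝ, IsTest U φ → ∫ x, f x * fderiv ℝ φ x v ∂μ = - ∫ x, g x * φ x ∂μ

/-- `f`, with gradient `g`, belongs to `H¹₀(Ω)`, the closure of `𝒟(Ω)` in `H¹(Ω)`. -/
def MemH10 {n : ℕ} (Ω : Set (Sp n)) (f : Sp n → ℝ) (g : Fin n → Sp n → ℝ) : Prop :=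
  ∀ ε : ℝ≥0∞, 0 < ε → ∃ φ : Sp n → ℝ, IsTest Ω φ ∧
    eLpNorm (fun x => f x - φ x) 2 (measOmega Ω) < ε ∧
    ∀ i, eLpNorm (fun x => g i x - fderiv ℝ φ x (dir i)) 2 (measOmega Ω) < ε

/-- A function in `W^{2,∞}(Ω)` together with its weak gradient and its weak Hessian. -/
structure W2Inf {n : ℕ} (Ω : Set (Sp n)) where
  val : Sp n → ℝ
  grad : Fin n → Sp n → ℝ
  hess : Fin n → Fin n → Sp n → ℝ
  memLp_val : MemLp val ∞ (measOmega Ω)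
  memLp_grad : ∀ i, MemLp (grad i) ∞ (measOmega Ω)
  memLp_hess : ∀ i j, MemLp (hess i j) ∞ (measOmega Ω)
  weak_grad : ∀ i, HasWeakDeriv Ω (measOmega Ω) (dir i) val (grad i)
  weak_hess : ∀ i j, HasWeakDeriv Ω (measOmega Ω) (dir j) (grad i) (hess i j)

/-- A function in `H²(Ω) ∩ H¹₀(Ω)` together with its weak gradient and its weak Hessian. -/
structure H2H10 {n : ℕ} (Ω : Set (Sp n)) where
  val : Sp n → ℝ
  grad : Fin n → Sp n → ℝ
  hess : Fin n → Fin n → Sp n → ℝ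
  memLp_val : MemLp val 2 (measOmega Ω)
  memLp_grad : ∀ i, MemLp (grad i) 2 (measOmega Ω)
  memLp_hess : ∀ i j, MemLp (hess i j) 2 (measOmega Ω)
  weak_grad : ∀ i, HasWeakDeriv Ω (measOmega Ω) (dir i) val (grad i)
  weak_hess : ∀ i j, HasWeakDeriv Ω (measOmega Ω) (dir j) (grad i) (hess i j)
  memH10 : MemH10 Ω val grad

/-! ### The state space `Y` -/

/-- Candidates `(y, ∇y, ∇²y, ẏ)`, all components in `L²(Q)`. -/
abbrev Jet {n : ℕ} (Ω : Set (Sp n)) (T : ℝ) : Type :=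
  L2Q Ω T × (Fin n → L2Q Ω T) × (Fin n → Fin n → L2Q Ω T) × L2Q Ω T

/-- The state space `Y = {y ∈ H^{2,1}(Q) ; y = 0 on Σ}`.  An element is recorded together with its
distributional derivatives `∇y, ∇²y, ẏ ∈ L²(Q)`, which are determined by `y`; the topology induced
by the product of the `L²(Q)` topologies is the one of the `H^{2,1}(Q)` norm.
The condition `y = 0` on `Σ` says that `y(·,t) ∈ H¹₀(Ω)` for a.e. `t`. -/
def stateSpace {n : ℕ} (Ω : Set (Sp n)) (T : ℝ) : Set (Jet Ω T) :=
  {y | (∀ i, HasWeakDeriv (Ω ×ˢ Ioo 0 T) (measQ Ω T) (dir i, 0) y.1 (y.2.1 i)) ∧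
    (∀ i j, HasWeakDeriv (Ω ×ˢ Ioo 0 T) (measQ Ω T) (dir j, 0) (y.2.1 i) (y.2.2.1 i j)) ∧
    HasWeakDeriv (Ω ×ˢ Ioo 0 T) (measQ Ω T) (0, 1) y.1 y.2.2.2 ∧
    ∀ᵐ t ∂(measT T), MemH10 Ω (fun x => y.1 (x, t)) (fun i x => y.2.1 i (x, t))}

/-- The space `Y` as a topological space. -/
abbrev Y {n : ℕ} (Ω : Set (Sp n)) (T : ℝ) : Type := ↥(stateSpace Ω T)

namespace Y

variable {n : ℕ} {Ω : Set (Sp n)} {T : ℝ}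

/-- The function `y`. -/
def val (y : Y Ω T) : L2Q Ω T := y.1.1

/-- The spatial derivative `∂y/∂x_i`. -/
def grad (y : Y Ω T) (i : Fin n) : L2Q Ω T := y.1.2.1 i

/-- The Laplacian `Δy`. -/
def lap (y : Y Ω T) (p : Sp n × ℝ) : ℝ := ∑ i, y.1.2.2.1 i i p

/-- The time derivative `ẏ`. -/
def dt (y : Y Ω T) : L2Q Ω T := y.1.2.2.2

/-- `Z` is the representative of `y` in `C([0,T]; L²(Ω))`, so that `y(·,t) = Z t` for *every*
`t ∈ [0,T]`. -/
def IsTimeRep (y : Y Ω T) (Z : ℝ → L2Omega Ω) : Prop :=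
  ContinuousOn Z (Icc 0 T) ∧
    ∀ᵐ t ∂(measT T), (fun x => y.val (x, t)) =ᵐ[measOmega Ω] Z t

end Y

/-! ### The optimal control problem -/

/-- The data of the state equation
`ẏ - Δy + γ y³ = f + y ∑_{i=0}^m u_i b_i` in `Q`, `y = 0` on `Σ`, `y(·,0) = y₀`, with `u₀ ≡ 1`,
of the control bounds `lo_i ≤ u_i ≤ hi_i` (`1 ≤ i ≤ m`), and of the state constraints
`g_j(y(·,t)) = ∫_Ω c_j(x) y(x,t) dx + d_j ≤ 0` (`1 ≤ j ≤ q`). -/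
structure Problem (n m q : ℕ) where
  Ω : Set (Sp n)
  isOpen_Ω : IsOpen Ω
  T : ℝ
  T_pos : 0 < T
  γ : ℝ
  γ_nonneg : 0 ≤ γ
  f : L2Q Ω T
  y0 : L2Omega Ω
  y0_memH10 : ∃ g : Fin n → L2Omega Ω, MemH10 Ω y0 (fun i => g i)
  /-- `b 0` multiplies the constant `u₀ ≡ 1`; the control `u_i`, `i : Fin m`, multiplies
  `b i.succ`. -/
  b : Fin (m + 1) → W2Inf Ω
  lo : Fin m → ℝ
  hi : Fin m → ℝ
  lo_lt_hi : ∀ i, lo i < hi i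
  c : Fin q → H2H10 Ω
  d : Fin q → ℝ

namespace Problem

variable {n m q : ℕ} (P : Problem n m q)

/-- The potential `∑_{i=0}^m u_i(t) b_i(x)`, with `u₀ ≡ 1`. -/
def potential (u : Fin m → L2T P.T) (p : Sp n × ℝ) : ℝ :=
  (P.b 0).val p.1 + ∑ i, u i p.2 * (P.b i.succ).val p.1

/-- The value `∫_Ω c_j(x) y(x) dx + d_j` of the `j`-th state constraint. -/
def g (j : Fin q) (y : L2Omega P.Ω) : ℝ :=
  (∫ x, (P.c j).val x * y x ∂(measOmega P.Ω)) + P.d j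

/-- An admissible trajectory `(u, y)`; `yt` is the representative of `y` in `C([0,T]; L²(Ω))`. -/
structure Trajectory where
  u : Fin m → L2T P.T
  y : Y P.Ω P.T
  yt : ℝ → L2Omega P.Ω
  isTimeRep : y.IsTimeRep yt
  initial : yt 0 = P.y0
  state_eq : ∀ᵐ p ∂(measQ P.Ω P.T),
    y.dt p - y.lap p + P.γ * (y.val p) ^ 3 = P.f p + y.val p * P.potential u p
  control_bounds : ∀ i, ∀ᵐ t ∂(measT P.T), P.lo i ≤ u i t ∧ u i t ≤ P.hi i
  state_constraints : ∀ j, ∀ t ∈ Icc 0 P.T, P.g j (yt t) ≤ 0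

namespace Trajectory

variable {P} (tr : P.Trajectory)

/-! ### Linearization, strict critical cone, Goh transform -/

/-- `(Az)(x,t) = -Δz + 3γ ȳ² z - ∑_{i=0}^m ū_i b_i z`. -/
def opA (z : Y P.Ω P.T) (p : Sp n × ℝ) : ℝ :=
  - z.lap p + 3 * P.γ * (tr.y.val p) ^ 2 * z.val p - P.potential tr.u p * z.val p

/-- `z = z[v]`: `ż + A z = ∑_{i=1}^m v_i b_i ȳ` in `Q`, `z = 0` on `Σ`, `z(·,0) = 0`. -/
def SolvesLinearized (z : Y P.Ω P.T) (v : Fin m → L2T P.T) : Prop :=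
  (∀ᵐ p ∂(measQ P.Ω P.T),
    z.dt p + tr.opA z p = ∑ i, v i p.2 * (P.b i.succ).val p.1 * tr.y.val p) ∧
  ∃ Z, z.IsTimeRep Z ∧ Z 0 = 0

/-- The contact set `{t ∈ [0,T] ; g_j(ȳ(·,t)) = 0}` of the `j`-th state constraint. -/
def contactC (j : Fin q) : Set ℝ := {t | t ∈ Icc 0 P.T ∧ P.g j (tr.yt t) = 0}

/-- The strict critical cone `C_s`: pairs `(z[v], v)` such that `v_i = 0` a.e. where `ū_i` is at
one of its bounds and `∫_Ω c_j(x) z[v](x,t) dx = 0` on the contact set of the `j`-th state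
constraint. -/
def strictCriticalCone : Set (Y P.Ω P.T × (Fin m → L2T P.T)) :=
  {zv | tr.SolvesLinearized zv.1 zv.2 ∧
    (∀ i, ∀ᵐ t ∂(measT P.T), (tr.u i t = P.lo i ∨ tr.u i t = P.hi i) → zv.2 i t = 0) ∧
    ∃ Z, zv.1.IsTimeRep Z ∧
      ∀ j, ∀ t ∈ tr.contactC j, ∫ x, (P.c j).val x * Z t x ∂(measOmega P.Ω) = 0}

/-- The space `Y × L²(0,T)^m × ℝ^m` of triples `(ζ, w, h)`. -/
abbrev Triple (P : Problem n m q) : Type := Y P.Ω P.T × (Fin m → L2T P.T) × (Fin m → ℝ)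

/-- `PC`: triples `(ζ, w, w(T))` with `w(t) = ∫_0^t v(s) ds` and `ζ = z - ∑_i ȳ b_i w_i` for some
`(z, v) ∈ C_s`. -/
def PC : Set (Triple P) :=
  {e | ∃ zv ∈ tr.strictCriticalCone,
    (∀ i, ∀ᵐ t ∂(measT P.T), e.2.1 i t = ∫ s in (0 : ℝ)..t, zv.2 i s) ∧
    (∀ i, e.2.2 i = ∫ s in (0 : ℝ)..P.T, zv.2 i s) ∧
    ∀ᵐ p ∂(measQ P.Ω P.T),
      e.1.val p = zv.1.val p - ∑ i, tr.y.val p * (P.b i.succ).val p.1 * e.2.1 i p.2}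

/-- `PC₂`: the closure of `PC` in `Y × L²(0,T)^m × ℝ^m`. -/
def PC2 : Set (Triple P) := closure tr.PC

/-- `B¹_i = -f b_i + 2 ∇ȳ·∇b_i + ȳ Δb_i - 2γ ȳ³ b_i`. -/
def B1 (i : Fin m) (p : Sp n × ℝ) : ℝ :=
  - (P.f p * (P.b i.succ).val p.1)
    + 2 * ∑ l, tr.y.grad l p * (P.b i.succ).grad l p.1
    + tr.y.val p * ∑ l, (P.b i.succ).hess l l p.1
    - 2 * P.γ * (tr.y.val p) ^ 3 * (P.b i.succ).val p.1

/-- `ζ = ζ[w]`: `ζ̇ + A ζ = B¹ · w` in `Q`, `ζ = 0` on `Σ`, `ζ(·,0) = 0`. -/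
def SolvesGoh (ζ : Y P.Ω P.T) (w : Fin m → L2T P.T) : Prop :=
  (∀ᵐ p ∂(measQ P.Ω P.T), ζ.dt p + tr.opA ζ p = ∑ i, tr.B1 i p * w i p.2) ∧
  ∃ Z, ζ.IsTimeRep Z ∧ Z 0 = 0

/-! ### Arcs and active constraints

The arcs are `(τ_k, τ_{k+1})`, `k : Fin r`, with `τ_k = τ k.castSucc` and `τ_{k+1} = τ k.succ`. -/

variable {r : ℕ} (τ : Fin (r + 1) → ℝ)

/-- The `k`-th arc `(τ_k, τ_{k+1})`. -/
def arc (k : Fin r) : Set ℝ := Ioo (τ k.castSucc) (τ k.succ)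

open Classical in
/-- Active lower bounds on the `k`-th arc. -/
def Blo (k : Fin r) : Finset (Fin m) :=
  Finset.univ.filter fun i => ∀ᵐ t ∂(volume.restrict (arc τ k)), tr.u i t = P.lo i

open Classical in
/-- Active upper bounds on the `k`-th arc. -/
def Bhi (k : Fin r) : Finset (Fin m) :=
  Finset.univ.filter fun i => ∀ᵐ t ∂(volume.restrict (arc τ k)), tr.u i t = P.hi i

/-- Active bounds on the `k`-th arc. -/
def B (k : Fin r) : Finset (Fin m) := tr.Blo τ k ∪ tr.Bhi τ k

open Classical in
/-- Active state constraints on the `k`-th arc. -/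
def C (k : Fin r) : Finset (Fin q) :=
  Finset.univ.filter fun j => ∀ t ∈ arc τ k, P.g j (tr.yt t) = 0

/-- `0 = τ_0 < ⋯ < τ_r = T` is a subdivision such that the set of active constraints is (almost
everywhere) constant on each arc `(τ_k, τ_{k+1})`. -/
structure IsArcSubdivision : Prop where
  first : τ 0 = 0
  last : τ (Fin.last r) = P.T
  strictMono : StrictMono τ
  lower : ∀ k, ∀ i ∉ tr.Blo τ k, ∀ᵐ t ∂(volume.restrict (arc τ k)), tr.u i t ≠ P.lo i
  upper : ∀ k, ∀ i ∉ tr.Bhi τ k, ∀ᵐ t ∂(volume.restrict (arc τ k)), tr.u i t ≠ P.hi i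
  state : ∀ k, ∀ j ∉ tr.C τ k, ∀ᵐ t ∂(volume.restrict (arc τ k)), P.g j (tr.yt t) ≠ 0

/-- `M_{ij}(t) = ∫_Ω b_i(x) c_j(x) ȳ(x,t) dx`. -/
def M (t : ℝ) : Matrix (Fin m) (Fin q) ℝ :=
  Matrix.of fun i j =>
    ∫ x, (P.b i.succ).val x * (P.c j).val x * tr.yt t x ∂(measOmega P.Ω)

/-- `M̄_k(t)`: the rows of `M(t)` with index not in `B_k` and its columns with index in `C_k`. -/
def Mbar (k : Fin r) (t : ℝ) : Matrix {i // i ∉ tr.B τ k} {j // j ∈ tr.C τ k} ℝ :=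
  (tr.M t).submatrix Subtype.val Subtype.val

/-- Uniform local controllability: `|C_k| ≤ m - |B_k|` for all `k`, and there is `α > 0` with
`|M̄_k(t) μ| ≥ α |μ|` (Euclidean norms) for all `μ` and a.e. `t` in each arc `(τ_k, τ_{k+1})`. -/
def LocallyControllable : Prop :=
  (∀ k, (tr.C τ k).card + (tr.B τ k).card ≤ m) ∧
  ∃ α : ℝ, 0 < α ∧ ∀ k, ∀ᵐ t ∂(volume.restrict (arc τ k)),
    ∀ μ : {j // j ∈ tr.C τ k} → ℝ,
      α * √(∑ j, μ j ^ 2) ≤ √(∑ i, (tr.Mbar τ k t *ᵥ μ) i ^ 2)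

/-! ### The operators `𝒜` and `ℬ`, junction conditions and the set `PC₂'` -/

/-- Row indices of `𝒜^k(t)`: active bounds, then active state constraints. -/
abbrev Rows (k : Fin r) : Type := {i // i ∈ tr.B τ k} ⊕ {j // j ∈ tr.C τ k}

/-- The matrix `𝒜^k(t)`, of size `(|B_k| + |C_k|) × m`: the rows are the basis vectors `e_i`,
`i ∈ B_k`, and the columns `M_j(t)` of `M(t)`, `j ∈ C_k`. -/
def calA (k : Fin r) (t : ℝ) : Matrix (tr.Rows τ k) (Fin m) ℝ :=
  Matrix.of (Sum.elim (fun i => Pi.single i.1 1) (fun j i => tr.M t i j.1))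

/-- `(ℬ^k w)(t)`, where `ζ = ζ[w]`: the components are the mean values of `w_i` over
`(τ_k, τ_{k+1})`, `i ∈ B_k`, and `-∫_Ω c_j(x) ζ(x,t) dx`, `j ∈ C_k`. -/
def calB (k : Fin r) (ζ : Y P.Ω P.T) (w : Fin m → L2T P.T) (t : ℝ) : tr.Rows τ k → ℝ :=
  Sum.elim
    (fun i => 1 / (τ k.succ - τ k.castSucc) * ∫ s in (τ k.castSucc)..(τ k.succ), w i.1 s)
    (fun j => - ∫ x, (P.c j.1).val x * ζ.val (x, t) ∂(measOmega P.Ω))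

/-- `w ∈ Ker(𝒜 - ℬ)`, where `ζ = ζ[w]`. -/
def InKer (ζ : Y P.Ω P.T) (w : Fin m → L2T P.T) : Prop :=
  ∀ k : Fin r, ∀ᵐ t ∂(volume.restrict (arc τ k)),
    tr.calA τ k t *ᵥ (fun i => w i t) = tr.calB τ k ζ w t

/-- `lam` is (a continuous representative of) the coefficient of `w` on the `k`-th arc, i.e.
`w(t) = w₀(t) + 𝒜^k(t)ᵀ lam(t)` with `w₀(t) ∈ Ker 𝒜^k(t)`. -/
def IsCoeff (k : Fin r) (w : Fin m → L2T P.T) (lam : ℝ → tr.Rows τ k → ℝ) : Prop :=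
  ContinuousOn lam (arc τ k) ∧
  ∀ᵐ t ∂(volume.restrict (arc τ k)),
    tr.calA τ k t *ᵥ ((fun i => w i t) - (tr.calA τ k t)ᵀ *ᵥ lam t) = 0

/-- `W` is the value `w(τ_{k+1}⁻)` of `w` at the right end of the `k`-th arc, modulo the kernel of
`𝒜^k(τ_{k+1})`: the left limit of the component `𝒜^k(t)ᵀ lam(t)` of `w(t)`. -/
def HasLeftValue (k : Fin r) (w : Fin m → L2T P.T) (W : Fin m → ℝ) : Prop :=
  ∃ lam, tr.IsCoeff τ k w lam ∧
    Tendsto (fun t => (tr.calA τ k t)ᵀ *ᵥ lam t) (𝓝[<] (τ k.succ)) (𝓝 W)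

/-- `W` is the value `w(τ_k⁺)` of `w` at the left end of the `k`-th arc, modulo the kernel of
`𝒜^k(τ_k)`: the right limit of the component `𝒜^k(t)ᵀ lam(t)` of `w(t)`. -/
def HasRightValue (k : Fin r) (w : Fin m → L2T P.T) (W : Fin m → ℝ) : Prop :=
  ∃ lam, tr.IsCoeff τ k w lam ∧
    Tendsto (fun t => (tr.calA τ k t)ᵀ *ᵥ lam t) (𝓝[>] (τ k.castSucc)) (𝓝 W)

/-- `c` is a linear combination of the rows of `𝒜^k(τ)` and also one of the rows of `𝒜^{k'}(τ)`,
where `k' = k + 1` and `τ = τ_{k+1}`. -/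
def IsJunctionVector (k k' : Fin r) (c : Fin m → ℝ) : Prop :=
  (∃ ν : tr.Rows τ k → ℝ, c = (tr.calA τ k (τ k.succ))ᵀ *ᵥ ν) ∧
  (∃ ν' : tr.Rows τ k' → ℝ, c = (tr.calA τ k' (τ k.succ))ᵀ *ᵥ ν')

/-- The junction condition `c · (w(τ⁺) - w(τ⁻)) = 0` at `τ = τ_{k+1}`, where `k' = k + 1`; the
one-sided values exist. -/
def JunctionCondition (k k' : Fin r) (c : Fin m → ℝ) (w : Fin m → L2T P.T) : Prop :=
  ∃ Wminus Wplus : Fin m → ℝ, tr.HasLeftValue τ k w Wminus ∧ tr.HasRightValue τ k' w Wplus ∧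
    c ⬝ᵥ (Wplus - Wminus) = 0

/-- `PC₂'`: triples `(ζ[w], w, h)` with `w ∈ Ker(𝒜 - ℬ)` satisfying all junction conditions. -/
def PC2' : Set (Triple P) :=
  {e | tr.SolvesGoh e.1 e.2.1 ∧ tr.InKer τ e.1 e.2.1 ∧
    ∀ k k' : Fin r, (k' : ℕ) = k + 1 → ∀ c, tr.IsJunctionVector τ k k' c →
      tr.JunctionCondition τ k k' c e.2.1}

end Trajectory

end Problem

end BilinHeat

end

noncomputable section

namespace BilinHeat

/-! ### Test functions -/

section Test

variable {V : Type*} [NormedAddCommGroup V] [NormedSpace ℝ V] {U : Set V} {φ : V → ℝ}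

/-! For an element of `PC` the function w is a primitive of v, hence continuous, and 𝒜^k w = ℬ^k w
holds at every point of each closed arc. Indeed v_i vanishes on the arc for i ∈ B_k, so w_i is
constant and equals its mean; and pairing ζ = z − ȳ Σ b_i w_i with c_j, where ∫ c_j z = 0, gives M_j
· w = −∫ c_j ζ (`exists_rep_of_mem_PC`). If c = 𝒜^k(τ)ᵀν = 𝒜^{k+1}(τ)ᵀν' at a junction time τ, then
ν · ℬ^k w(τ) and ν' · ℬ^{k+1} w(τ) both equal c · w(τ).

In the closure w is merely square integrable and has no point values, but the identity ν · ℬ^k w(τ)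
= ν' · ℬ^{k+1} w(τ) survives: it involves only means of the w_i and the numbers ∫ c_j ζ(·,τ), all
continuous on Y × L² (`contB_junction`). For the latter numbers this rests on ζ(·,t) = ∫_0^t ζ̇ ds,
a bounded operator `primL` applied to ζ̇ ∈ L²(Q) (`Y.IsTimeRep.eq_primL`).

Local controllability extends to the closed arcs by continuity of M and makes the rows of 𝒜^k(t)
independent. Hence λ = (𝒜𝒜ᵀ)⁻¹ℬ^k w is a coefficient of w that is continuous up to the ends of the
arc (`exists_coeff`), and c · w(τ⁻) = ν · 𝒜𝒜ᵀλ(τ) = ν · ℬ^k w(τ). The same computation on the next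
arc gives (J).

The inclusion also needs the equation of ζ (`goh_equation`). Since ζ ∈ Y is given, its derivatives
need not be constructed: uniqueness of weak derivatives identifies them with the outcome of the
product rule. Much of the analysis goes into that rule, for factors b_i in W^{2,∞} and w_i a
primitive of an L² function. Equation and kernel relation pass to the closure pointwise a.e. along
subsequences (`spec_of_mem_PC2`). -/

theorem IsTest.smooth_mul (hφ : IsTest U φ) {a : V → ℝ} (ha : ContDiff ℝ (⊤ : ℕ∞) a) :
    IsTest U (fun x => a x * φ x) :=
  ⟨ha.mul hφ.1, hφ.2.1.mul_left, (tsupport_mul_subset_right).trans hφ.2.2⟩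

theorem IsTest.differentiable (hφ : IsTest U φ) : Differentiable ℝ φ :=
  hφ.1.differentiable (by simp)

theorem IsTest.continuous_fderiv_apply (hφ : IsTest U φ) (v : V) :
    Continuous fun x => fderiv ℝ φ x v :=
  (hφ.1.continuous_fderiv (by simp)).clm_apply continuous_const

theorem IsTest.hasCompactSupport_fderiv_apply (hφ : IsTest U φ) (v : V) :
    HasCompactSupport fun x => fderiv ℝ φ x v :=
  hφ.2.1.fderiv_apply ℝ v

variable [MeasurableSpace V] [OpensMeasurableSpace V] {μ : Measure V}

theorem IsTest.memLp [IsFiniteMeasureOnCompacts μ] (hφ : IsTest U φ) (p : ℝ≥0∞) :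
    MemLp φ p μ :=
  hφ.1.continuous.memLp_of_hasCompactSupport hφ.2.1

theorem IsTest.memLp_fderiv_apply [IsFiniteMeasureOnCompacts μ] (hφ : IsTest U φ)
    (p : ℝ≥0∞) (v : V) : MemLp (fun x => fderiv ℝ φ x v) p μ :=
  (hφ.continuous_fderiv_apply v).memLp_of_hasCompactSupport (hφ.hasCompactSupport_fderiv_apply v)

end Test

theorem IsTest.prod {V W : Type*} [NormedAddCommGroup V] [NormedSpace ℝ V]
    [NormedAddCommGroup W] [NormedSpace ℝ W] {U : Set V} {U' : Set W} {ψ : V → ℝ} {η : W → ℝ}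
    (hψ : IsTest U ψ) (hη : IsTest U' η) : IsTest (U ×ˢ U') (fun p : V × W => ψ p.1 * η p.2) := by
  have h : tsupport (fun p : V × W => ψ p.1 * η p.2) ⊆ tsupport ψ ×ˢ tsupport η := by
    refine closure_minimal ?_ ((isClosed_tsupport _).prod (isClosed_tsupport _))
    intro p hp
    have := mul_ne_zero_iff.1 (Function.mem_support.1 hp)
    exact ⟨subset_tsupport _ this.1, subset_tsupport _ this.2⟩
  refine ⟨(hψ.1.comp contDiff_fst).mul (hη.1.comp contDiff_snd), ?_,
    h.trans (prod_mono hψ.2.2 hη.2.2)⟩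
  exact (IsCompact.prod hψ.2.1 hη.2.1).of_isClosed_subset (isClosed_tsupport _) h

/-- The fundamental lemma of the calculus of variations, for a measure carried by U. The uniqueness,
density and du Bois-Reymond arguments reduce to it. -/
theorem ae_eq_zero_of_integral_isTest {V : Type*} [NormedAddCommGroup V] [NormedSpace ℝ V]
    [FiniteDimensional ℝ V] [MeasurableSpace V] [BorelSpace V] {U : Set V} (hU : IsOpen U)
    {μ : Measure V} (hμ : ∀ᵐ x ∂μ, x ∈ U) {F : V → ℝ} (hF : LocallyIntegrable F μ)
    (h : ∀ ψ, IsTest U ψ → ∫ x, ψ x * F x ∂μ = 0) : F =ᵐ[μ] 0 := by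
  filter_upwards [hμ, hU.ae_eq_zero_of_integral_contDiff_smul_eq_zero
    (hF.locallyIntegrableOn U) (fun g h1 h2 h3 => h g ⟨h1, h2, h3⟩)] with x hx h'
  exact h' hx

/-! ### Integrals against functions of one of the two variables -/

theorem ae_norm_le_of_memLp_top {α : Type*} [MeasurableSpace α] {μ : Measure α} {f : α → ℝ}
    (hf : MemLp f ∞ μ) : ∃ C : ℝ, ∀ᵐ x ∂μ, |f x| ≤ C := by
  refine ⟨(eLpNorm f ∞ μ).toReal, ?_⟩
  filter_upwards [ae_le_eLpNormEssSup (f := f) (μ := μ)] with x hx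
  rw [← eLpNorm_exponent_top] at hx
  simpa using ENNReal.toReal_mono hf.2.ne hx

section Fubini

variable {V W : Type*} [NormedAddCommGroup V] [NormedSpace ℝ V]
    [FiniteDimensional ℝ V] [MeasurableSpace V] [BorelSpace V]
    [MeasurableSpace W] {U : Set V} {μ : Measure V} {ν : Measure W} [SFinite μ] [SFinite ν]

/-- By Fubini only the marginal x ↦ ∫ H(x,t) dν(t) matters. It annihilates all test functions, so it
vanishes a.e. and may be paired with any bounded function. This handles multipliers that are not
differentiated, without smoothing them. -/
theorem integral_mul_fst_eq_zero (hU : IsOpen U) (hμ : ∀ᵐ x ∂μ, x ∈ U) {H : V × W → ℝ}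
    (hH : Integrable H (μ.prod ν))
    (h : ∀ ψ, IsTest U ψ → ∫ p, ψ p.1 * H p ∂(μ.prod ν) = 0) {b : V → ℝ}
    (hb : MemLp b ∞ μ) : ∫ p, b p.1 * H p ∂(μ.prod ν) = 0 := by
  have key : ∀ a : V → ℝ, MemLp a ∞ μ →
      ∫ p, a p.1 * H p ∂(μ.prod ν) = ∫ x, a x * ∫ t, H (x, t) ∂ν ∂μ := by
    intro a ha
    rw [integral_prod]
    · simp_rw [integral_const_mul]
    · obtain ⟨C, hC⟩ := ae_norm_le_of_memLp_top ha
      exact hH.bdd_mul ha.1.comp_fst (Measure.quasiMeasurePreserving_fst.ae hC)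
  have h0 : (fun x => ∫ t, H (x, t) ∂ν) =ᵐ[μ] 0 := by
    refine ae_eq_zero_of_integral_isTest hU hμ hH.integral_prod_left.locallyIntegrable ?_
    intro ψ hψ
    rw [← key ψ, h ψ hψ]
    obtain ⟨C, hC⟩ := hψ.2.1.exists_bound_of_continuous hψ.1.continuous
    exact memLp_top_of_bound hψ.1.continuous.aestronglyMeasurable C (ae_of_all _ hC)
  rw [key b hb]
  refine integral_eq_zero_of_ae ?_
  filter_upwards [h0] with x hx
  simp [hx]

theorem integral_mul_snd_eq_zero (hU : IsOpen U) (hμ : ∀ᵐ x ∂μ, x ∈ U) {H : W × V → ℝ}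
    (hH : Integrable H (ν.prod μ))
    (h : ∀ ψ, IsTest U ψ → ∫ p, ψ p.2 * H p ∂(ν.prod μ) = 0) {b : V → ℝ}
    (hb : MemLp b ∞ μ) : ∫ p, b p.2 * H p ∂(ν.prod μ) = 0 := by
  have e : ∀ a : V → ℝ, ∫ p, a p.1 * H p.swap ∂(μ.prod ν) = ∫ p, a p.2 * H p ∂(ν.prod μ) :=
    fun a => integral_prod_swap (fun p => a p.2 * H p)
  rw [← e]
  exact integral_mul_fst_eq_zero hU hμ hH.swap (fun ψ hψ => (e ψ).trans (h ψ hψ)) hb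

end Fubini

/-! ### Functions of one variable -/

/-- Integration by parts for two absolutely continuous primitives. -/
theorem integral_primitive_mul {T : ℝ} (hT : 0 ≤ T) {v H : ℝ → ℝ}
    (hv : IntegrableOn v (Ioo 0 T)) (hH : IntegrableOn H (Ioo 0 T)) :
    ∫ t in Ioo 0 T, (∫ s in (0 : ℝ)..t, v s) * H t =
      ∫ s in Ioo 0 T, v s * ∫ t in s..T, H t := by
  have e : ∀ F : ℝ → ℝ, ∫ t in Ioo 0 T, F t = ∫ t in (0 : ℝ)..T, F t := fun F => by
    rw [intervalIntegral.integral_of_le hT, integral_Ioc_eq_integral_Ioo]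
  have ii : ∀ {F : ℝ → ℝ}, IntegrableOn F (Ioo 0 T) → IntervalIntegrable F volume 0 T :=
    fun hF => (intervalIntegrable_iff_integrableOn_Ioo_of_le hT).2 hF
  have hv' := ii hv
  have hH' := ii hH
  have h1 := hv'.absolutelyContinuousOnInterval_intervalIntegral (c := 0) left_mem_uIcc
  -- The primitive of v starts at 0 and that of H at T, so both boundary terms vanish.
  have h2 := hH'.absolutelyContinuousOnInterval_intervalIntegral (c := T) right_mem_uIcc
  have h3 := h1.integral_mul_deriv_eq_deriv_mul h2
  have a1 := hv'.ae_hasDerivAt_integral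
  have a2 := hH'.ae_hasDerivAt_integral
  rw [e, e]
  have c1 : ∫ t in (0 : ℝ)..T, (∫ s in (0 : ℝ)..t, v s) * H t =
      ∫ x in (0 : ℝ)..T, (∫ s in (0 : ℝ)..x, v s) * deriv (fun x => ∫ t in T..x, H t) x := by
    refine intervalIntegral.integral_congr_ae ?_
    filter_upwards [a2] with x hx hx'
    rw [(hx (uIoc_subset_uIcc hx') T right_mem_uIcc).deriv]
  have c2 : ∫ x in (0 : ℝ)..T, v x * (∫ t in T..x, H t) =
      ∫ x in (0 : ℝ)..T, deriv (fun x => ∫ s in (0 : ℝ)..x, v s) x * (∫ t in T..x, H t) := by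
    refine intervalIntegral.integral_congr_ae ?_
    filter_upwards [a1] with x hx hx'
    rw [(hx (uIoc_subset_uIcc hx') 0 left_mem_uIcc).deriv]
  rw [c1, h3, ← c2]
  simp only [intervalIntegral.integral_same, mul_zero, zero_mul, sub_zero, zero_sub]
  rw [← intervalIntegral.integral_neg]
  refine intervalIntegral.integral_congr fun s _ => ?_
  rw [intervalIntegral.integral_symm s T, mul_neg, neg_neg]

theorem IsTest.exists_Icc {T : ℝ} (hT : 0 < T) {η : ℝ → ℝ} (hη : IsTest (Ioo 0 T) η) :
    ∃ a b, 0 < a ∧ a ≤ b ∧ b < T ∧ ∀ t, t ∉ Icc a b → η t = 0 := by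
  rcases (tsupport η).eq_empty_or_nonempty with h | h
  · refine ⟨T / 2, T / 2, by linarith, le_rfl, by linarith, fun t _ => ?_⟩
    exact image_eq_zero_of_notMem_tsupport (by simp [h])
  · have hc : IsCompact (tsupport η) := hη.2.1
    have h1 := hη.2.2 (hc.sInf_mem h)
    have h2 := hη.2.2 (hc.sSup_mem h)
    refine ⟨sInf (tsupport η), sSup (tsupport η), h1.1,
      csInf_le_csSup h hc.bddBelow hc.bddAbove, h2.2, fun t ht => ?_⟩
    exact image_eq_zero_of_notMem_tsupport fun h' =>
      ht ⟨csInf_le hc.bddBelow h', le_csSup hc.bddAbove h'⟩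

theorem contDiff_primitive {θ : ℝ → ℝ} (hθ : ContDiff ℝ (⊤ : ℕ∞) θ) :
    ContDiff ℝ (⊤ : ℕ∞) (fun t => ∫ s in (0 : ℝ)..t, θ s) ∧
      ∀ t, HasDerivAt (fun t => ∫ s in (0 : ℝ)..t, θ s) (θ t) t := by
  have hd : ∀ t, HasDerivAt (fun t => ∫ s in (0 : ℝ)..t, θ s) (θ t) t := fun t =>
    (hθ.continuous.integral_hasStrictDerivAt 0 t).hasDerivAt
  refine ⟨?_, hd⟩
  -- As ∞ = ∞ + 1, smoothness of the derivative θ is enough.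
  rw [show ((⊤ : ℕ∞) : WithTop ℕ∞) = (⊤ : ℕ∞) + 1 by simp, contDiff_succ_iff_deriv]
  refine ⟨fun t => (hd t).differentiableAt, by simp, ?_⟩
  rw [show deriv (fun t => ∫ s in (0 : ℝ)..t, θ s) = θ from funext fun t => (hd t).deriv]
  exact hθ

/-- Let [a, b] ⊂ (0,T) carry θ. The primitive vanishes before a trivially and after b because θ has
mean zero, so it is again compactly supported in (0,T). -/
theorem IsTest.primitive {T : ℝ} (hT : 0 < T) {θ : ℝ → ℝ} (hθ : IsTest (Ioo 0 T) θ)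
    (h0 : ∫ t in Ioo 0 T, θ t = 0) :
    IsTest (Ioo 0 T) (fun t => ∫ s in (0 : ℝ)..t, θ s) ∧
      ∀ t, HasDerivAt (fun t => ∫ s in (0 : ℝ)..t, θ s) (θ t) t := by
  obtain ⟨hc, hd⟩ := contDiff_primitive hθ.1
  obtain ⟨a, b, ha, hab, hb, hz⟩ := hθ.exists_Icc hT
  have hz' : ∀ t, t ∉ Icc a b → ∫ s in (0 : ℝ)..t, θ s = 0 := by
    intro t ht
    rw [mem_Icc, not_and_or, not_le, not_le] at ht
    rcases ht with ht | ht
    · refine (intervalIntegral.integral_congr fun s hs => hz s fun hs' => ?_).trans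
        intervalIntegral.integral_zero
      have : s ≤ max 0 t := (mem_uIcc.1 hs).elim (fun h => h.2.trans (le_max_right _ _))
        fun h => h.2.trans (le_max_left _ _)
      exact absurd (hs'.1.trans this) (not_le.2 (max_lt ha ht))
    · have e1 : ∫ s in (0 : ℝ)..T, θ s = 0 := by
        rw [intervalIntegral.integral_of_le hT.le, integral_Ioc_eq_integral_Ioo, h0]
      have e2 : ∫ s in t..T, θ s = 0 := by
        refine (intervalIntegral.integral_congr fun s hs => hz s fun hs' => ?_).trans
          intervalIntegral.integral_zero
        have : min t T ≤ s := (mem_uIcc.1 hs).elim (fun h => (min_le_left _ _).trans h.1)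
          fun h => (min_le_right _ _).trans h.1
        exact absurd (this.trans hs'.2) (not_le.2 (lt_min ht hb))
      have ci : ∀ x y, IntervalIntegrable θ volume x y := fun x y =>
        hθ.1.continuous.intervalIntegrable x y
      have := intervalIntegral.integral_add_adjacent_intervals (ci 0 t) (ci t T)
      linarith
  have hs : tsupport (fun t => ∫ s in (0 : ℝ)..t, θ s) ⊆ Icc a b := by
    refine closure_minimal (fun t ht => ?_) isClosed_Icc
    by_contra h
    exact ht (hz' t h)
  exact ⟨⟨hc, isCompact_Icc.of_isClosed_subset (isClosed_tsupport _) hs,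
    hs.trans fun t ht => ⟨ha.trans_le ht.1, ht.2.trans_lt hb⟩⟩, hd⟩

theorem exists_isTest_integral_one {T : ℝ} (hT : 0 < T) :
    ∃ ρ, IsTest (Ioo 0 T) ρ ∧ ∫ t in Ioo 0 T, ρ t = 1 := by
  let f : ContDiffBump (T / 2) := ⟨T / 8, T / 4, by linarith, by linarith⟩
  have hs : Metric.closedBall (T / 2) (T / 4) ⊆ Ioo 0 T := by
    rw [Real.closedBall_eq_Icc]
    exact fun t ht => ⟨by linarith [ht.1], by linarith [ht.2]⟩
  have ht : tsupport (f.normed volume) ⊆ Ioo 0 T := by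
    rw [f.tsupport_normed_eq]
    exact hs
  refine ⟨f.normed volume, ⟨f.contDiff_normed, f.hasCompactSupport_normed, ht⟩, ?_⟩
  rw [setIntegral_eq_integral_of_forall_compl_eq_zero, f.integral_normed]
  exact fun t h => image_eq_zero_of_notMem_tsupport fun h' => h (ht h')

/-- The lemma of du Bois-Reymond. -/
theorem exists_ae_eq_const_of_integral_mul_deriv {T : ℝ} (hT : 0 < T) {h : ℝ → ℝ}
    (hh : IntegrableOn h (Ioo 0 T))
    (h0 : ∀ η, IsTest (Ioo 0 T) η → ∫ t in Ioo 0 T, h t * deriv η t = 0) :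
    ∃ c, ∀ᵐ t ∂(measT T), h t = c := by
  obtain ⟨ρ, hρ, hρ1⟩ := exists_isTest_integral_one hT
  set c := ∫ t in Ioo 0 T, h t * ρ t with hc
  have hi : ∀ {g ψ : ℝ → ℝ}, IntegrableOn g (Ioo 0 T) → IsTest (Ioo 0 T) ψ →
      IntegrableOn (fun t => g t * ψ t) (Ioo 0 T) := by
    intro g ψ hg hψ
    obtain ⟨C, hC⟩ := hψ.2.1.exists_bound_of_continuous hψ.1.continuous
    exact hg.mul_bdd hψ.1.continuous.aestronglyMeasurable (ae_of_all _ hC)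
  have hint : ∀ {ψ : ℝ → ℝ}, IsTest (Ioo 0 T) ψ → IntegrableOn ψ (Ioo 0 T) :=
    fun hψ => memLp_one_iff_integrable.1 (hψ.memLp 1)
  refine ⟨c, ?_⟩
  have hsub : IntegrableOn (fun t => h t - c) (Ioo 0 T) := hh.sub (by simp)
  have := ae_eq_zero_of_integral_isTest isOpen_Ioo
    (ae_restrict_mem (μ := volume) (measurableSet_Ioo (a := 0) (b := T)))
    hsub.locallyIntegrable ?_
  · filter_upwards [this] with t ht
    exact sub_eq_zero.1 ht
  intro θ hθ
  set m := ∫ t in Ioo 0 T, θ t with hm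
  -- Subtracting m ρ, with ρ of mass one, removes the mean of θ; the difference is then the
  -- derivative of a test function.
  have ht : IsTest (Ioo 0 T) (fun t => θ t - m * ρ t) := by
    refine ⟨hθ.1.sub (contDiff_const.mul hρ.1), hθ.2.1.sub hρ.2.1.mul_left, ?_⟩
    refine (tsupport_sub _ _).trans (union_subset hθ.2.2 ?_)
    exact (tsupport_mul_subset_right (f := fun _ => m)).trans hρ.2.2
  obtain ⟨h1, h2⟩ := ht.primitive hT (by
    rw [integral_sub (hint hθ) ((hint hρ).const_mul m), integral_const_mul, hρ1, mul_one, sub_self])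
  have h3 := h0 _ h1
  simp_rw [fun t => (h2 t).deriv] at h3
  have h4 : ∫ t in Ioo 0 T, h t * (θ t - m * ρ t) =
      (∫ t in Ioo 0 T, h t * θ t) - m * c := by
    rw [hc, ← integral_const_mul, ← integral_sub (hi hh hθ) ((hi hh hρ).const_mul m)]
    exact integral_congr_ae (ae_of_all _ fun t => by simp only; ring)
  have h5 : ∫ t in Ioo 0 T, θ t * (h t - c) = (∫ t in Ioo 0 T, h t * θ t) - c * m := by
    rw [hm, ← integral_const_mul, ← integral_sub (hi hh hθ) ((hint hθ).const_mul c)]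
    exact integral_congr_ae (ae_of_all _ fun t => by simp only; ring)
  change ∫ t in Ioo 0 T, θ t * (h t - c) = 0
  rw [h5]
  linarith

/-! ### Square integrability of tensor products and bounded multiples. -/

section Prod

variable {α β : Type*} [MeasurableSpace α] [MeasurableSpace β] {μ : Measure α} {ν : Measure β}

theorem memLp_top_comp_fst [SFinite ν] {f : α → ℝ} (hf : MemLp f ∞ μ) :
    MemLp (fun p : α × β => f p.1) ∞ (μ.prod ν) := by
  obtain ⟨C, hC⟩ := ae_norm_le_of_memLp_top hf
  exact memLp_top_of_bound hf.1.comp_fst C (Measure.quasiMeasurePreserving_fst.ae hC)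

theorem memLp_top_comp_snd [SFinite μ] [SFinite ν] {f : β → ℝ} (hf : MemLp f ∞ ν) :
    MemLp (fun p : α × β => f p.2) ∞ (μ.prod ν) := by
  obtain ⟨C, hC⟩ := ae_norm_le_of_memLp_top hf
  exact memLp_top_of_bound hf.1.comp_snd C (Measure.quasiMeasurePreserving_snd.ae hC)

theorem eLpNorm_tensor [SFinite ν] {f : α → ℝ} {g : β → ℝ} (hf : AEStronglyMeasurable f μ)
    (hg : AEStronglyMeasurable g ν) :
    eLpNorm (fun p : α × β => f p.1 * g p.2) 2 (μ.prod ν) = eLpNorm f 2 μ * eLpNorm g 2 ν := by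
  simp only [eLpNorm_eq_lintegral_rpow_enorm_toReal (p := 2) (by simp) (by simp), enorm_mul]
  rw [← ENNReal.mul_rpow_of_nonneg _ _ (by simp)]
  congr 1
  rw [← lintegral_prod_mul (hf.enorm.pow_const _) (hg.enorm.pow_const _)]
  refine lintegral_congr fun p => ?_
  rw [ENNReal.mul_rpow_of_nonneg _ _ (by simp)]

theorem memLp_tensor [SFinite ν] {f : α → ℝ} {g : β → ℝ} (hf : MemLp f 2 μ) (hg : MemLp g 2 ν) :
    MemLp (fun p : α × β => f p.1 * g p.2) 2 (μ.prod ν) := by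
  refine ⟨hf.1.comp_fst.mul hg.1.comp_snd, ?_⟩
  rw [eLpNorm_tensor hf.1 hg.1]
  exact ENNReal.mul_lt_top hf.2 hg.2

end Prod

theorem integrable_mul_of_memLp {α : Type*} [MeasurableSpace α] {μ : Measure α} {f g : α → ℝ}
    (hf : MemLp f 2 μ) (hg : MemLp g 2 μ) : Integrable (fun x => f x * g x) μ :=
  hf.integrable_mul hg

theorem memLp_mul_top {α : Type*} [MeasurableSpace α] {μ : Measure α} {f g : α → ℝ}
    (hf : MemLp f 2 μ) (hg : MemLp g ∞ μ) : MemLp (fun x => f x * g x) 2 μ :=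
  hg.mul' hf

/-! ### Product rules for weak derivatives -/

theorem HasWeakDeriv.congr {V : Type*} [NormedAddCommGroup V] [NormedSpace ℝ V]
    [MeasurableSpace V] {U : Set V} {μ : Measure V} {v : V} {y g y' g' : V → ℝ}
    (h : HasWeakDeriv U μ v y g) (hy : y =ᵐ[μ] y') (hg : g =ᵐ[μ] g') : HasWeakDeriv U μ v y' g' := by
  intro φ hφ
  have e1 : ∫ x, y' x * fderiv ℝ φ x v ∂μ = ∫ x, y x * fderiv ℝ φ x v ∂μ :=
    integral_congr_ae (by filter_upwards [hy] with x hx; rw [hx])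
  have e2 : ∫ x, g' x * φ x ∂μ = ∫ x, g x * φ x ∂μ :=
    integral_congr_ae (by filter_upwards [hg] with x hx; rw [hx])
  rw [e1, e2, h φ hφ]

section WeakDeriv

theorem fderiv_comp_fst {E F : Type*} [NormedAddCommGroup E] [NormedSpace ℝ E]
    [NormedAddCommGroup F] [NormedSpace ℝ F] {a : E → ℝ} (p : E × F) (ha : DifferentiableAt ℝ a p.1)
    (v : E × F) : fderiv ℝ (fun p : E × F => a p.1) p v = fderiv ℝ a p.1 v.1 := by
  have h : HasFDerivAt (fun p : E × F => a p.1) ((fderiv ℝ a p.1).comp (.fst ℝ E F)) p :=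
    ha.hasFDerivAt.comp p hasFDerivAt_fst
  rw [h.fderiv]
  rfl

theorem fderiv_comp_snd {E F : Type*} [NormedAddCommGroup E] [NormedSpace ℝ E]
    [NormedAddCommGroup F] [NormedSpace ℝ F] {a : F → ℝ} (p : E × F) (ha : DifferentiableAt ℝ a p.2)
    (v : E × F) : fderiv ℝ (fun p : E × F => a p.2) p v = fderiv ℝ a p.2 v.2 := by
  have h : HasFDerivAt (fun p : E × F => a p.2) ((fderiv ℝ a p.2).comp (.snd ℝ E F)) p :=
    ha.hasFDerivAt.comp p hasFDerivAt_snd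
  rw [h.fderiv]
  rfl

variable {V : Type*} [NormedAddCommGroup V] [NormedSpace ℝ V] [MeasurableSpace V]
  [OpensMeasurableSpace V] {U : Set V} {μ : Measure V} [IsFiniteMeasureOnCompacts μ] {v : V}
  {y g : V → ℝ}

theorem hasWeakDeriv_iff (hy : MemLp y 2 μ) (hg : MemLp g 2 μ) :
    HasWeakDeriv U μ v y g ↔
      ∀ φ, IsTest U φ → ∫ x, (y x * fderiv ℝ φ x v + g x * φ x) ∂μ = 0 := by
  refine forall₂_congr fun φ hφ => ?_
  rw [integral_add (integrable_mul_of_memLp hy (hφ.memLp_fderiv_apply 2 v))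
    (integrable_mul_of_memLp hg (hφ.memLp 2)), ← eq_neg_iff_add_eq_zero]

/-- The function aφ is again a test function, even when a has no compact support. The rougher
multipliers below are reduced to this case. -/
theorem HasWeakDeriv.integral_smooth_mul (h : HasWeakDeriv U μ v y g) (hy : MemLp y 2 μ)
    (hg : MemLp g 2 μ) {φ a : V → ℝ} (hφ : IsTest U φ) (ha : ContDiff ℝ (⊤ : ℕ∞) a) :
    ∫ x, (y x * (a x * fderiv ℝ φ x v + fderiv ℝ a x v * φ x) + g x * (a x * φ x)) ∂μ = 0 := by
  refine Eq.trans ?_ ((hasWeakDeriv_iff hy hg).1 h _ (hφ.smooth_mul ha))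
  refine integral_congr_ae (ae_of_all _ fun x => ?_)
  simp only
  rw [fderiv_fun_mul (ha.differentiable (by simp) x) (hφ.differentiable x)]
  simp only [add_apply, smul_apply, smul_eq_mul]
  ring

theorem HasWeakDeriv.sub {y' g' : V → ℝ} (h : HasWeakDeriv U μ v y g)
    (h' : HasWeakDeriv U μ v y' g') (hy : MemLp y 2 μ) (hg : MemLp g 2 μ)
    (hy' : MemLp y' 2 μ) (hg' : MemLp g' 2 μ) :
    HasWeakDeriv U μ v (fun x => y x - y' x) (fun x => g x - g' x) := by
  intro φ hφ
  have m1 := hφ.memLp_fderiv_apply (μ := μ) 2 v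
  have m2 := hφ.memLp (μ := μ) 2
  simp_rw [sub_mul]
  rw [integral_sub (integrable_mul_of_memLp hy m1) (integrable_mul_of_memLp hy' m1),
    integral_sub (integrable_mul_of_memLp hg m2) (integrable_mul_of_memLp hg' m2),
    h φ hφ, h' φ hφ]
  ring

theorem HasWeakDeriv.add {y' g' : V → ℝ} (h : HasWeakDeriv U μ v y g)
    (h' : HasWeakDeriv U μ v y' g') (hy : MemLp y 2 μ) (hg : MemLp g 2 μ)
    (hy' : MemLp y' 2 μ) (hg' : MemLp g' 2 μ) :
    HasWeakDeriv U μ v (fun x => y x + y' x) (fun x => g x + g' x) := by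
  intro φ hφ
  have m1 := hφ.memLp_fderiv_apply (μ := μ) 2 v
  have m2 := hφ.memLp (μ := μ) 2
  simp_rw [add_mul]
  rw [integral_add (integrable_mul_of_memLp hy m1) (integrable_mul_of_memLp hy' m1),
    integral_add (integrable_mul_of_memLp hg m2) (integrable_mul_of_memLp hg' m2),
    h φ hφ, h' φ hφ]
  ring

theorem HasWeakDeriv.sum {ι : Type*} (s : Finset ι) {y g : ι → V → ℝ}
    (h : ∀ i ∈ s, HasWeakDeriv U μ v (y i) (g i)) (hy : ∀ i ∈ s, MemLp (y i) 2 μ)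
    (hg : ∀ i ∈ s, MemLp (g i) 2 μ) :
    HasWeakDeriv U μ v (fun x => ∑ i ∈ s, y i x) (fun x => ∑ i ∈ s, g i x) := by
  intro φ hφ
  have m1 := hφ.memLp_fderiv_apply (μ := μ) 2 v
  have m2 := hφ.memLp (μ := μ) 2
  simp_rw [Finset.sum_mul]
  rw [integral_finsetSum _ fun i hi => integrable_mul_of_memLp (hy i hi) m1,
    integral_finsetSum _ fun i hi => integrable_mul_of_memLp (hg i hi) m2,
    ← Finset.sum_neg_distrib]
  exact Finset.sum_congr rfl fun i hi => h i hi φ hφ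

/-- Identifies the derivatives recorded in an element of `Y` with those computed by product rules.
-/
theorem HasWeakDeriv.ae_unique [FiniteDimensional ℝ V] [BorelSpace V] (hU : IsOpen U)
    (hμ : ∀ᵐ x ∂μ, x ∈ U)
    {g' : V → ℝ} (h : HasWeakDeriv U μ v y g) (h' : HasWeakDeriv U μ v y g')
    (hg : MemLp g 2 μ) (hg' : MemLp g' 2 μ) : g =ᵐ[μ] g' := by
  have := FiniteDimensional.proper ℝ V
  have hl : LocallyIntegrable (fun x => g x - g' x) μ := by
    have : IsLocallyFiniteMeasure μ := inferInstance
    exact (hg.sub hg').locallyIntegrable (by simp)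
  have := ae_eq_zero_of_integral_isTest hU hμ hl fun ψ hψ => by
    have e := (h ψ hψ).symm.trans (h' ψ hψ)
    have m2 := hψ.memLp (μ := μ) 2
    simp_rw [mul_sub, mul_comm (ψ _)]
    rw [integral_sub (integrable_mul_of_memLp hg m2) (integrable_mul_of_memLp hg' m2),
      neg_inj.1 e, sub_self]
  filter_upwards [this] with x hx
  exact sub_eq_zero.1 hx

end WeakDeriv

/-! ### Product rules on the cylinder Q: undifferentiated factors and primitives in time. -/

section Cylinder

variable {n : ℕ} {Ω : Set (Sp n)} {T : ℝ} {y g : Sp n × ℝ → ℝ}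

theorem ae_mem_cylinder (hΩ : IsOpen Ω) : ∀ᵐ p ∂(measQ Ω T), p ∈ Ω ×ˢ Ioo 0 T := by
  rw [measQ, Measure.prod_restrict]
  exact ae_restrict_mem (hΩ.measurableSet.prod measurableSet_Ioo)

theorem integrable_test_pair {v : Sp n × ℝ} (hy : MemLp y 2 (measQ Ω T))
    (hg : MemLp g 2 (measQ Ω T)) {φ : Sp n × ℝ → ℝ} (hφ : IsTest (Ω ×ˢ Ioo 0 T) φ) :
    Integrable (fun p => y p * fderiv ℝ φ p v + g p * φ p) (measQ Ω T) :=
  (integrable_mul_of_memLp hy (hφ.memLp_fderiv_apply 2 v)).add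
    (integrable_mul_of_memLp hg (hφ.memLp 2))

/-- Multiplication of a time derivative by a bounded function of the space variable. -/
theorem HasWeakDeriv.time_mul_space (hΩ : IsOpen Ω) {b : Sp n → ℝ}
    (h : HasWeakDeriv (Ω ×ˢ Ioo 0 T) (measQ Ω T) (0, 1) y g)
    (hy : MemLp y 2 (measQ Ω T)) (hg : MemLp g 2 (measQ Ω T)) (hb : MemLp b ∞ (measOmega Ω)) :
    HasWeakDeriv (Ω ×ˢ Ioo 0 T) (measQ Ω T) (0, 1) (fun p => y p * b p.1)
      (fun p => g p * b p.1) := by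
  have hb' := memLp_top_comp_fst (ν := measT T) hb
  rw [hasWeakDeriv_iff (memLp_mul_top hy hb') (memLp_mul_top hg hb')]
  intro φ hφ
  refine Eq.trans ?_ (integral_mul_fst_eq_zero hΩ (ae_restrict_mem hΩ.measurableSet)
    (integrable_test_pair (v := (0, 1)) hy hg hφ) (fun ψ hψ => ?_) hb)
  · exact integral_congr_ae (ae_of_all _ fun p => by simp only; ring)
  have ha : ContDiff ℝ (⊤ : ℕ∞) (fun p : Sp n × ℝ => ψ p.1) := hψ.1.comp contDiff_fst
  refine Eq.trans ?_ (h.integral_smooth_mul hy hg hφ ha)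
  refine integral_congr_ae (ae_of_all _ fun p => ?_)
  have : fderiv ℝ (fun p : Sp n × ℝ => ψ p.1) p (0, 1) = 0 := by
    rw [fderiv_comp_fst p (hψ.differentiable p.1), map_zero]
  simp only [this]
  ring

/-- Multiplication of a space derivative by a bounded function of time. -/
theorem HasWeakDeriv.space_mul_time {d : Sp n} {w : ℝ → ℝ}
    (h : HasWeakDeriv (Ω ×ˢ Ioo 0 T) (measQ Ω T) (d, 0) y g)
    (hy : MemLp y 2 (measQ Ω T)) (hg : MemLp g 2 (measQ Ω T)) (hw : MemLp w ∞ (measT T)) :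
    HasWeakDeriv (Ω ×ˢ Ioo 0 T) (measQ Ω T) (d, 0) (fun p => y p * w p.2)
      (fun p => g p * w p.2) := by
  have hw' := memLp_top_comp_snd (μ := measOmega Ω) hw
  rw [hasWeakDeriv_iff (memLp_mul_top hy hw') (memLp_mul_top hg hw')]
  intro φ hφ
  refine Eq.trans ?_ (integral_mul_snd_eq_zero isOpen_Ioo (ae_restrict_mem measurableSet_Ioo)
    (integrable_test_pair (v := (d, 0)) hy hg hφ) (fun ψ hψ => ?_) hw)
  · exact integral_congr_ae (ae_of_all _ fun p => by simp only; ring)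
  have ha : ContDiff ℝ (⊤ : ℕ∞) (fun p : Sp n × ℝ => ψ p.2) := hψ.1.comp contDiff_snd
  refine Eq.trans ?_ (h.integral_smooth_mul hy hg hφ ha)
  refine integral_congr_ae (ae_of_all _ fun p => ?_)
  have : fderiv ℝ (fun p : Sp n × ℝ => ψ p.2) p (d, 0) = 0 := by
    rw [fderiv_comp_snd p (hψ.differentiable p.2), map_zero]
  simp only [this]
  ring

theorem continuousOn_primitive {v : ℝ → ℝ} (hT : 0 ≤ T) (hv : IntegrableOn v (Ioo 0 T)) :
    ContinuousOn (fun t => ∫ s in (0 : ℝ)..t, v s) (Icc 0 T) := by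
  have := intervalIntegral.continuousOn_primitive_interval (f := v) (μ := volume) (a := 0) (b := T)
  rw [uIcc_of_le hT] at this
  exact this ((integrableOn_Icc_iff_integrableOn_Ioo).2 hv)

theorem memLp_top_of_continuousOn {w : ℝ → ℝ} (hw : ContinuousOn w (Icc 0 T)) :
    MemLp w ∞ (measT T) := by
  obtain ⟨C, hC⟩ := isCompact_Icc.exists_bound_of_continuousOn hw
  refine memLp_top_of_bound
    ((hw.mono Ioo_subset_Icc_self).aestronglyMeasurable measurableSet_Ioo) C ?_
  filter_upwards [ae_restrict_mem measurableSet_Ioo] with t ht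
  exact hC t (Ioo_subset_Icc_self ht)

theorem integrableOn_of_memLp_two {v : ℝ → ℝ} (hv : MemLp v 2 (measT T)) :
    IntegrableOn v (Ioo 0 T) :=
  hv.integrable (by norm_num)

/-- With K the projection of the support of φ to Ω, one has |φ| ≤ C 1_K(x). As K is compact it has
finite measure, so the product is dominated by a tensor product in L², even if Ω has infinite
measure. -/
theorem IsTest.memLp_time_mul {φ : Sp n × ℝ → ℝ} (hφ : IsTest (Ω ×ˢ Ioo 0 T) φ) {v : ℝ → ℝ}
    (hv : MemLp v 2 (measT T)) : MemLp (fun p => v p.2 * φ p) 2 (measQ Ω T) := by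
  obtain ⟨C, hC⟩ := hφ.2.1.exists_bound_of_continuous hφ.1.continuous
  have hK : IsCompact (Prod.fst '' tsupport φ) := hφ.2.1.isCompact.image continuous_fst
  have h1 : MemLp ((Prod.fst '' tsupport φ).indicator fun _ => C) 2 (measOmega Ω) :=
    memLp_indicator_const 2 hK.measurableSet C (Or.inr hK.measure_lt_top.ne)
  refine (memLp_tensor h1 hv).mono
    (hv.1.comp_snd.mul hφ.1.continuous.aestronglyMeasurable) (ae_of_all _ fun p => ?_)
  by_cases hp : p ∈ tsupport φ
  · rw [indicator_of_mem (mem_image_of_mem _ hp), norm_mul, norm_mul, mul_comm]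
    gcongr
    exact (hC p).trans (le_abs_self C)
  · rw [image_eq_zero_of_notMem_tsupport hp, mul_zero, norm_zero]
    positivity

/-- Multiplication of a time derivative by the primitive of a square integrable function. -/
theorem HasWeakDeriv.time_mul_primitive (hT : 0 < T) {v : ℝ → ℝ}
    (h : HasWeakDeriv (Ω ×ˢ Ioo 0 T) (measQ Ω T) (0, 1) y g)
    (hy : MemLp y 2 (measQ Ω T)) (hg : MemLp g 2 (measQ Ω T)) (hv : MemLp v 2 (measT T)) :
    HasWeakDeriv (Ω ×ˢ Ioo 0 T) (measQ Ω T) (0, 1) (fun p => y p * ∫ s in (0 : ℝ)..p.2, v s)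
      (fun p => g p * (∫ s in (0 : ℝ)..p.2, v s) + y p * v p.2) := by
  intro φ hφ
  rw [← add_eq_zero_iff_eq_neg]
  have iH := integrable_test_pair (v := (0, 1)) hy hg hφ
  have iF : Integrable (fun p => y p * φ p) (measQ Ω T) :=
    integrable_mul_of_memLp hy (hφ.memLp 2)
  set H : Sp n × ℝ → ℝ := fun p => y p * fderiv ℝ φ p (0, 1) + g p * φ p with hH
  set Ht : ℝ → ℝ := fun t => ∫ x, H (x, t) ∂(measOmega Ω) with hHt
  set Ft : ℝ → ℝ := fun t => ∫ x, y (x, t) * φ (x, t) ∂(measOmega Ω) with hFt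
  have iHt : IntegrableOn Ht (Ioo 0 T) := iH.integral_prod_right
  have iFt : IntegrableOn Ft (Ioo 0 T) := iF.integral_prod_right
  have hprim : ContinuousOn (fun s => ∫ t in s..T, Ht t) (Icc 0 T) := by
    have := intervalIntegral.continuousOn_primitive_interval_left (f := Ht) (μ := volume)
      (a := 0) (b := T)
    rw [uIcc_of_le hT.le] at this
    exact this ((integrableOn_Icc_iff_integrableOn_Ioo).2 iHt)
  -- the weak formulation as a linear functional of `v`
  have key : ∀ u : ℝ → ℝ, MemLp u 2 (measT T) →
      ∫ p, ((∫ s in (0 : ℝ)..p.2, u s) * H p + u p.2 * (y p * φ p)) ∂(measQ Ω T) =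
        ∫ s in Ioo 0 T, u s * ((∫ t in s..T, Ht t) + Ft s) := by
    intro u hu
    have iu := integrableOn_of_memLp_two hu
    have hw := memLp_top_of_continuousOn (continuousOn_primitive hT.le iu)
    have i1 : Integrable (fun p => (∫ s in (0 : ℝ)..p.2, u s) * H p) (measQ Ω T) := by
      obtain ⟨C, hC⟩ := ae_norm_le_of_memLp_top (memLp_top_comp_snd (μ := measOmega Ω) hw)
      exact iH.bdd_mul hw.1.comp_snd hC
    have i2 : Integrable (fun p => u p.2 * (y p * φ p)) (measQ Ω T) := by
      refine (integrable_mul_of_memLp hy (hφ.memLp_time_mul hu)).congr (ae_of_all _ fun p => ?_)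
      simp only
      ring
    rw [integral_add i1 i2, integral_prod_symm _ i1, integral_prod_symm _ i2]
    simp_rw [integral_const_mul]
    rw [integral_primitive_mul hT.le iu iHt]
    simp_rw [mul_add]
    rw [integral_add]
    · obtain ⟨C, hC⟩ := ae_norm_le_of_memLp_top (memLp_top_of_continuousOn hprim)
      exact iu.mul_bdd (memLp_top_of_continuousOn hprim).1 hC
    · refine i2.integral_prod_right.congr (ae_of_all _ fun t => ?_)
      simp only [hFt]
      rw [integral_const_mul]
  -- For a test function u the primitive is smooth and the ordinary product rule makes the
  -- functional zero. Its kernel therefore vanishes a.e., and with it the functional at every v ∈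
  -- L².
  have hzero : (fun s => (∫ t in s..T, Ht t) + Ft s) =ᵐ[measT T] 0 := by
    refine ae_eq_zero_of_integral_isTest isOpen_Ioo (ae_restrict_mem measurableSet_Ioo)
      (Integrable.locallyIntegrable ?_) fun u hu => ?_
    · exact ((hprim.integrableOn_Icc).mono_set Ioo_subset_Icc_self).add iFt
    rw [← key u (hu.memLp 2)]
    obtain ⟨hs, hd⟩ := contDiff_primitive hu.1
    have ha : ContDiff ℝ (⊤ : ℕ∞) (fun p : Sp n × ℝ => ∫ s in (0 : ℝ)..p.2, u s) :=
      hs.comp contDiff_snd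
    refine Eq.trans ?_ (h.integral_smooth_mul hy hg hφ ha)
    refine integral_congr_ae (ae_of_all _ fun p => ?_)
    have : fderiv ℝ (fun p : Sp n × ℝ => ∫ s in (0 : ℝ)..p.2, u s) p (0, 1) = u p.2 := by
      rw [fderiv_comp_snd p (hd p.2).differentiableAt, (hd p.2).hasFDerivAt.fderiv]
      simp
    simp only [this, hH]
    ring
  have hw := memLp_top_comp_snd (μ := measOmega Ω) (memLp_top_of_continuousOn
    (continuousOn_primitive hT.le (integrableOn_of_memLp_two hv)))
  rw [← integral_add]
  · trans ∫ p, ((∫ s in (0 : ℝ)..p.2, v s) * H p + v p.2 * (y p * φ p)) ∂(measQ Ω T)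
    · exact integral_congr_ae (ae_of_all _ fun p => by simp only [hH]; ring)
    rw [key v hv]
    refine integral_eq_zero_of_ae ?_
    filter_upwards [hzero] with s hs
    rw [hs]
    simp
  · exact integrable_mul_of_memLp (memLp_mul_top hy hw) (hφ.memLp_fderiv_apply 2 _)
  · refine ((integrable_mul_of_memLp (memLp_mul_top hg hw) (hφ.memLp 2)).add
      (integrable_mul_of_memLp hy (hφ.memLp_time_mul hv))).congr (ae_of_all _ fun p => ?_)
    simp only [Pi.add_apply]
    ring

end Cylinder

/-! ### Mollification of W^{1,∞} functions. -/

section Mollify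

open scoped Convolution

variable {n : ℕ} {Ω : Set (Sp n)}

/-- Averaging against a nonnegative kernel of mass one does not increase the essential bound; this
supplies the uniform bounds for dominated convergence. -/
theorem abs_normed_convolution_le (ρ : ContDiffBump (0 : Sp n)) {f : Sp n → ℝ} {C : ℝ}
    (hf : ∀ᵐ x, |f x| ≤ C) (x : Sp n) :
    |(ρ.normed volume ⋆[ContinuousLinearMap.lsmul ℝ ℝ, volume] f) x| ≤ C := by
  have hi : Integrable (fun t => ρ.normed volume t * C) :=
    (ρ.continuous_normed.integrable_of_hasCompactSupport ρ.hasCompactSupport_normed).mul_const C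
  rw [convolution_def, ← Real.norm_eq_abs]
  refine (norm_integral_le_of_norm_le hi ?_).trans ?_
  · have : ∀ᵐ t, |f (x - t)| ≤ C :=
      (quasiMeasurePreserving_sub_left_of_right_invariant volume x).ae hf
    filter_upwards [this] with t ht
    rw [ContinuousLinearMap.lsmul_apply, norm_smul, Real.norm_of_nonneg (ρ.nonneg_normed t)]
    exact mul_le_mul_of_nonneg_left ht (ρ.nonneg_normed t)
  · rw [integral_mul_const, ρ.integral_normed, one_mul]

/-- Mollification commutes with weak differentiation. -/
theorem fderiv_normed_convolution {d : Sp n} {b β : Sp n → ℝ}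
    (h : HasWeakDeriv Ω (measOmega Ω) d b β) (hΩ : IsOpen Ω)
    (hb : LocallyIntegrable (Ω.indicator b)) (ρ : ContDiffBump (0 : Sp n)) {x : Sp n}
    (hx : Metric.closedBall x ρ.rOut ⊆ Ω) :
    fderiv ℝ (ρ.normed volume ⋆[ContinuousLinearMap.lsmul ℝ ℝ, volume] Ω.indicator b) x d =
      (ρ.normed volume ⋆[ContinuousLinearMap.lsmul ℝ ℝ, volume] Ω.indicator β) x := by
  have hρ : ContDiff ℝ (⊤ : ℕ∞) (ρ.normed volume) := ρ.contDiff_normed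
  have hs := ρ.hasCompactSupport_normed (μ := volume)
  have hc : HasCompactSupport (fderiv ℝ (ρ.normed volume)) := hs.fderiv ℝ
  rw [(hs.hasFDerivAt_convolution_left (ContinuousLinearMap.lsmul ℝ ℝ)
    (hρ.of_le (by exact_mod_cast le_top)) hb x).fderiv, convolution_eq_swap, convolution_eq_swap,
    ContinuousLinearMap.integral_apply]
  · simp only [ContinuousLinearMap.precompL_apply, ContinuousLinearMap.lsmul_apply, smul_eq_mul]
    -- The reflected kernel centred at x is supported in the closed ball contained in Ω, so it is
    -- admissible in the definition of the weak derivative.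
    have ht : IsTest Ω (fun z => ρ.normed volume (x - z)) := by
      have hsub : tsupport (fun z => ρ.normed volume (x - z)) ⊆ Metric.closedBall x ρ.rOut := by
        refine closure_minimal (fun z hz => ?_) Metric.isClosed_closedBall
        have : x - z ∈ Function.support (ρ.normed volume) := hz
        rw [ρ.support_normed_eq, Metric.mem_ball, dist_zero_right] at this
        rw [Metric.mem_closedBall, dist_comm, dist_eq_norm]
        exact this.le
      exact ⟨hρ.comp (contDiff_const.sub contDiff_id),
        (isCompact_closedBall x ρ.rOut).of_isClosed_subset (isClosed_tsupport _) hsub,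
        hsub.trans hx⟩
    have hd : ∀ z, fderiv ℝ (fun z => ρ.normed volume (x - z)) z d =
        - fderiv ℝ (ρ.normed volume) (x - z) d := fun z => by
      have := ((hρ.differentiable (by simp) (x - z)).hasFDerivAt.comp z
        ((hasFDerivAt_const x z).sub (hasFDerivAt_id z)))
      have e : HasFDerivAt (fun z => ρ.normed volume (x - z)) _ z := this
      rw [e.fderiv]
      simp
    have key := h _ ht
    simp_rw [hd, mul_neg, integral_neg, neg_inj] at key
    have ind : ∀ F G : Sp n → ℝ, ∫ t, F t * Ω.indicator G t = ∫ t, G t * F t ∂(measOmega Ω) := by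
      intro F G
      rw [← integral_indicator hΩ.measurableSet]
      refine integral_congr_ae (ae_of_all _ fun t => ?_)
      by_cases ht : t ∈ Ω <;> simp [ht, mul_comm]
    rw [ind, ind, key]
  · have : ConvolutionExistsAt (fderiv ℝ (ρ.normed volume)) (Ω.indicator b) x
        ((ContinuousLinearMap.lsmul ℝ ℝ).precompL (Sp n)) volume :=
      (hc.convolutionExists_left _ (hρ.continuous_fderiv (by simp)) hb) x
    exact this.integrable_swap

/-- A function of `W^{1,∞}(Ω)` is approximated by smooth functions, boundedly almost everywhere and
together with its derivative, near compact sets. -/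
theorem exists_smooth_approx (hΩ : IsOpen Ω) {d : Sp n} {b β : Sp n → ℝ}
    (hb : MemLp b ∞ (measOmega Ω)) (hβ : MemLp β ∞ (measOmega Ω))
    (h : HasWeakDeriv Ω (measOmega Ω) d b β) {K : Set (Sp n)} (hK : IsCompact K) (hKΩ : K ⊆ Ω) :
    ∃ (a : ℕ → Sp n → ℝ) (C : ℝ), (∀ k, ContDiff ℝ (⊤ : ℕ∞) (a k)) ∧ (∀ k x, |a k x| ≤ C) ∧
      (∀ k, ∀ x ∈ K, |fderiv ℝ (a k) x d| ≤ C) ∧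
      (∀ᵐ x ∂(measOmega Ω), Tendsto (fun k => a k x) atTop (𝓝 (b x))) ∧
      (∀ᵐ x ∂(measOmega Ω), x ∈ K → Tendsto (fun k => fderiv ℝ (a k) x d) atTop (𝓝 (β x))) := by
  obtain ⟨δ, hδ, hδΩ⟩ := hK.exists_cthickening_subset_open hΩ hKΩ
  have hball : ∀ x ∈ K, ∀ r ≤ δ, Metric.closedBall x r ⊆ Ω := fun x hx r hr =>
    (Metric.closedBall_subset_closedBall hr).trans
      ((Metric.closedBall_subset_cthickening hx δ).trans hδΩ)
  have hpos : ∀ k : ℕ, (0 : ℝ) < δ / (2 * (k + 1)) := fun k => by positivity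
  -- The outer radii δ/(k+1) never exceed δ, which keeps the mollification at points of K inside Ω.
  -- They are twice the inner radii, which gives the bounded ratio required for a.e. convergence of
  -- the mollifications.
  let ρ : ℕ → ContDiffBump (0 : Sp n) := fun k =>
    ⟨δ / (2 * (k + 1)), 2 * (δ / (2 * (k + 1))), hpos k, by linarith [hpos k]⟩
  have hout : ∀ k, (ρ k).rOut = δ / (k + 1) := fun k => by
    change 2 * (δ / (2 * ((k : ℝ) + 1))) = _
    field_simp
  have hlim : Tendsto (fun k => (ρ k).rOut) atTop (𝓝 0) := by
    simp_rw [hout]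
    exact tendsto_const_div_atTop_nhds_zero_nat δ |>.comp (tendsto_add_atTop_nat 1) |>.congr
      (fun k => by simp)
  have hrat : ∀ᶠ k in atTop, (ρ k).rOut ≤ 2 * (ρ k).rIn := Eventually.of_forall fun k => le_rfl
  have hle : ∀ k, (ρ k).rOut ≤ δ := fun k => by
    rw [hout]
    exact div_le_self hδ.le (by simp)
  have ext : ∀ {f : Sp n → ℝ}, MemLp f ∞ (measOmega Ω) → LocallyIntegrable (Ω.indicator f) ∧
      ∃ C, ∀ᵐ x, |Ω.indicator f x| ≤ C := fun {f} hf => by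
    have := (memLp_indicator_iff_restrict (p := ∞) (f := f) hΩ.measurableSet).2 hf
    exact ⟨this.locallyIntegrable le_top, ae_norm_le_of_memLp_top this⟩
  obtain ⟨lb, C₁, hC₁⟩ := ext hb
  obtain ⟨lβ, C₂, hC₂⟩ := ext hβ
  have conv : ∀ {f : Sp n → ℝ}, LocallyIntegrable (Ω.indicator f) → ∀ᵐ x ∂(measOmega Ω),
      Tendsto (fun k => ((ρ k).normed volume ⋆[ContinuousLinearMap.lsmul ℝ ℝ, volume]
        Ω.indicator f) x) atTop (𝓝 (f x)) := fun {f} hf => by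
    have := ContDiffBump.ae_convolution_tendsto_right_of_locallyIntegrable hlim hrat hf
    filter_upwards [ae_restrict_of_ae this, ae_restrict_mem hΩ.measurableSet] with x hx hxΩ
    rwa [indicator_of_mem hxΩ] at hx
  refine ⟨fun k => (ρ k).normed volume ⋆[ContinuousLinearMap.lsmul ℝ ℝ, volume] Ω.indicator b,
    max C₁ C₂, fun k => ?_, fun k x => ?_, fun k x hx => ?_, conv lb, ?_⟩
  · exact (ρ k).hasCompactSupport_normed.contDiff_convolution_left _ (ρ k).contDiff_normed lb
  · exact (abs_normed_convolution_le (ρ k) hC₁ x).trans (le_max_left _ _)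
  · rw [fderiv_normed_convolution h hΩ lb (ρ k) (hball x hx _ (hle k))]
    exact (abs_normed_convolution_le (ρ k) hC₂ x).trans (le_max_right _ _)
  · filter_upwards [conv lβ] with x hx hxK
    refine hx.congr fun k => ?_
    rw [fderiv_normed_convolution h hΩ lb (ρ k) (hball x hxK _ (hle k))]

end Mollify

/-! ### The product rule for a space derivative and a differentiated factor. -/

section Cylinder

variable {n : ℕ} {Ω : Set (Sp n)} {T : ℝ} {y g : Sp n × ℝ → ℝ}

/-- The product rule for a space derivative and a factor in `W^{1,∞}(Ω)`. -/
theorem HasWeakDeriv.space_mul_space (hΩ : IsOpen Ω) {d : Sp n} {b β : Sp n → ℝ}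
    (h : HasWeakDeriv (Ω ×ˢ Ioo 0 T) (measQ Ω T) (d, 0) y g)
    (hy : MemLp y 2 (measQ Ω T)) (hg : MemLp g 2 (measQ Ω T))
    (hb : MemLp b ∞ (measOmega Ω)) (hβ : MemLp β ∞ (measOmega Ω))
    (hbβ : HasWeakDeriv Ω (measOmega Ω) d b β) :
    HasWeakDeriv (Ω ×ˢ Ioo 0 T) (measQ Ω T) (d, 0) (fun p => y p * b p.1)
      (fun p => g p * b p.1 + y p * β p.1) := by
  have hb' := memLp_top_comp_fst (ν := measT T) hb
  have hβ' := memLp_top_comp_fst (ν := measT T) hβ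
  have hm : MemLp (fun p => g p * b p.1 + y p * β p.1) 2 (measQ Ω T) :=
    (memLp_mul_top hg hb').add (memLp_mul_top hy hβ')
  rw [hasWeakDeriv_iff (memLp_mul_top hy hb') hm]
  intro φ hφ
  have hK : IsCompact (Prod.fst '' tsupport φ) := hφ.2.1.isCompact.image continuous_fst
  obtain ⟨a, C, ha, haC, hdC, hab, haβ⟩ := exists_smooth_approx hΩ hb hβ hbβ hK (by
    rintro _ ⟨p, hp, rfl⟩
    exact (hφ.2.2 hp).1)
  have ha' : ∀ k, ContDiff ℝ (⊤ : ℕ∞) (fun p : Sp n × ℝ => a k p.1) := fun k =>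
    (ha k).comp contDiff_fst
  have hda : ∀ k (p : Sp n × ℝ), fderiv ℝ (fun p : Sp n × ℝ => a k p.1) p (d, 0) =
      fderiv ℝ (a k) p.1 d := fun k p =>
    fderiv_comp_fst p ((ha k).differentiable (by simp) p.1) _
  have zero := fun k => h.integral_smooth_mul hy hg hφ (ha' k)
  have i1 := integrable_mul_of_memLp hy (hφ.memLp_fderiv_apply 2 (d, 0))
  have i2 := integrable_mul_of_memLp hy (hφ.memLp 2)
  have i3 := integrable_mul_of_memLp hg (hφ.memLp 2)
  have lim := tendsto_integral_of_dominated_convergence (μ := measQ Ω T)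
    (F := fun k p => y p * (a k p.1 * fderiv ℝ φ p (d, 0) +
      fderiv ℝ (fun p : Sp n × ℝ => a k p.1) p (d, 0) * φ p) + g p * (a k p.1 * φ p))
    (f := fun p => y p * b p.1 * fderiv ℝ φ p (d, 0) + (g p * b p.1 + y p * β p.1) * φ p)
    (fun p => C * (|y p * fderiv ℝ φ p (d, 0)| + |y p * φ p| + |g p * φ p|))
    (fun k => ?_) (((i1.abs.add i2.abs).add i3.abs).const_mul C) (fun k => ?_) ?_
  · simp_rw [zero] at lim
    exact tendsto_nhds_unique lim tendsto_const_nhds |>.symm ▸ rfl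
  · have c1 := (ha' k).continuous
    have c2 := ((ha' k).continuous_fderiv (by simp)).clm_apply
      (continuous_const (y := ((d, 0) : Sp n × ℝ)))
    have c3 := hφ.continuous_fderiv_apply (d, 0)
    have c4 := hφ.1.continuous
    exact (hy.1.mul ((c1.mul c3).add (c2.mul c4)).aestronglyMeasurable).add
      (hg.1.mul (c1.mul c4).aestronglyMeasurable)
  · refine ae_of_all _ fun p => ?_
    have hC : 0 ≤ C := (abs_nonneg _).trans (haC 0 0)
    -- The derivative of a_k is controlled only over K, but elsewhere φ vanishes.
    have b2 : |fderiv ℝ (a k) p.1 d * φ p| ≤ C * |φ p| := by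
      by_cases hp : p ∈ tsupport φ
      · rw [abs_mul]
        exact mul_le_mul_of_nonneg_right (hdC k _ (mem_image_of_mem _ hp)) (abs_nonneg _)
      · simp [image_eq_zero_of_notMem_tsupport hp]
    rw [hda, Real.norm_eq_abs]
    calc |y p * (a k p.1 * fderiv ℝ φ p (d, 0) + fderiv ℝ (a k) p.1 d * φ p)
          + g p * (a k p.1 * φ p)|
        ≤ |y p| * (|a k p.1| * |fderiv ℝ φ p (d, 0)| + |fderiv ℝ (a k) p.1 d * φ p|)
          + |g p| * (|a k p.1| * |φ p|) := by
          refine (abs_add_le _ _).trans ?_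
          rw [abs_mul, abs_mul, abs_mul (a k p.1) (φ p), ← abs_mul (a k p.1) (fderiv ℝ φ p _)]
          gcongr
          exact abs_add_le _ _
      _ ≤ |y p| * (C * |fderiv ℝ φ p (d, 0)| + C * |φ p|) + |g p| * (C * |φ p|) := by
          gcongr <;> exact haC k _
      _ = _ := by rw [abs_mul, abs_mul, abs_mul]; ring
  · filter_upwards [Measure.quasiMeasurePreserving_fst.ae hab,
      Measure.quasiMeasurePreserving_fst.ae haβ] with p h1 h2
    simp_rw [hda]
    have h3 : Tendsto (fun k => fderiv ℝ (a k) p.1 d * φ p) atTop (𝓝 (β p.1 * φ p)) := by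
      by_cases hp : p ∈ tsupport φ
      · exact (h2 (mem_image_of_mem _ hp)).mul_const _
      · simp [image_eq_zero_of_notMem_tsupport hp]
    have := (((h1.mul_const (fderiv ℝ φ p (d, 0))).add h3).const_mul (y p)).add
      ((h1.mul_const (φ p)).const_mul (g p))
    convert this using 2
    ring

end Cylinder

/-! ### Time slices, and products of states with functions of time. -/

section Slices

variable {n : ℕ} {Ω : Set (Sp n)} {T : ℝ}

theorem ae_ae_of_ae_measQ {p : Sp n × ℝ → Prop} (h : ∀ᵐ q ∂(measQ Ω T), p q) :
    ∀ᵐ t ∂(measT T), ∀ᵐ x ∂(measOmega Ω), p (x, t) :=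
  Measure.ae_ae_of_ae_prod
    ((Measure.measurePreserving_swap (μ := measT T) (ν := measOmega Ω)).quasiMeasurePreserving.ae h)

theorem ae_measQ_of_ae_snd {p : ℝ → Prop} (h : ∀ᵐ t ∂(measT T), p t) :
    ∀ᵐ q ∂(measQ Ω T), p q.2 :=
  Measure.quasiMeasurePreserving_snd.ae h

theorem norm_sq_eq_integral {α : Type*} [MeasurableSpace α] {μ : Measure α} (f : Lp ℝ 2 μ) :
    ‖f‖ ^ 2 = ∫ x, f x ^ 2 ∂μ := by
  rw [← real_inner_self_eq_norm_sq, L2.inner_def]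
  refine integral_congr_ae (ae_of_all _ fun x => ?_)
  simp [sq]

/-- A product of two L² functions is in L²(Q) here because t ↦ ‖y(·,t)‖ is bounded on [0,T]. This
covers the term ȳ b_i v_i in the time derivative of ζ. -/
theorem Y.IsTimeRep.memLp_mul_time {y : Y Ω T} {Z : ℝ → L2Omega Ω}
    (hZ : y.IsTimeRep Z) {v : ℝ → ℝ} (hv : MemLp v 2 (measT T)) :
    MemLp (fun p => y.val p * v p.2) 2 (measQ Ω T) := by
  have hm : AEStronglyMeasurable (fun p => y.val p * v p.2) (measQ Ω T) :=
    (Lp.aestronglyMeasurable y.val).mul hv.1.comp_snd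
  obtain ⟨C, hC⟩ := isCompact_Icc.exists_bound_of_continuousOn hZ.1
  have hm2 : AEStronglyMeasurable (fun p => (y.val p * v p.2) ^ 2) (measQ Ω T) := hm.pow 2
  rw [memLp_two_iff_integrable_sq hm, integrable_prod_iff' hm2]
  have hsl : ∀ᵐ t ∂(measT T), (fun x => (y.val (x, t) * v t) ^ 2) =ᵐ[measOmega Ω]
      fun x => v t ^ 2 * Z t x ^ 2 := by
    filter_upwards [hZ.2] with t ht
    filter_upwards [ht] with x hx
    rw [hx]
    ring
  constructor
  · filter_upwards [hsl] with t ht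
    exact (((Lp.memLp (Z t)).integrable_sq).const_mul (v t ^ 2)).congr ht.symm
  · have hi : Integrable (fun t => C ^ 2 * v t ^ 2) (measT T) := (hv.integrable_sq).const_mul _
    refine hi.mono' hm2.norm.prod_swap.integral_prod_right' ?_
    filter_upwards [hsl, ae_restrict_mem measurableSet_Ioo] with t ht htm
    have e : ∫ x, ‖(y.val (x, t) * v t) ^ 2‖ ∂(measOmega Ω) = v t ^ 2 * ‖Z t‖ ^ 2 := by
      rw [norm_sq_eq_integral, ← integral_const_mul]
      refine integral_congr_ae ?_
      filter_upwards [ht] with x hx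
      rw [hx, Real.norm_of_nonneg (by positivity)]
    change ‖∫ x, ‖(y.val (x, t) * v t) ^ 2‖ ∂(measOmega Ω)‖ ≤ _
    rw [e, Real.norm_of_nonneg (by positivity), mul_comm]
    have := hC t (Ioo_subset_Icc_self htm)
    gcongr

/-- The product rule for a space derivative and a factor `b(x) w(t)`. -/
theorem HasWeakDeriv.space_mul_mul (hΩ : IsOpen Ω) {y g : Sp n × ℝ → ℝ} {d : Sp n}
    {b β : Sp n → ℝ} {w : ℝ → ℝ}
    (h : HasWeakDeriv (Ω ×ˢ Ioo 0 T) (measQ Ω T) (d, 0) y g)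
    (hy : MemLp y 2 (measQ Ω T)) (hg : MemLp g 2 (measQ Ω T))
    (hb : MemLp b ∞ (measOmega Ω)) (hβ : MemLp β ∞ (measOmega Ω))
    (hbβ : HasWeakDeriv Ω (measOmega Ω) d b β) (hw : MemLp w ∞ (measT T)) :
    HasWeakDeriv (Ω ×ˢ Ioo 0 T) (measQ Ω T) (d, 0) (fun p => y p * b p.1 * w p.2)
      (fun p => (g p * b p.1 + y p * β p.1) * w p.2) := by
  have hb' := memLp_top_comp_fst (ν := measT T) hb
  have hβ' := memLp_top_comp_fst (ν := measT T) hβ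
  have hm : MemLp (fun p => g p * b p.1 + y p * β p.1) 2 (measQ Ω T) :=
    (memLp_mul_top hg hb').add (memLp_mul_top hy hβ')
  exact (h.space_mul_space hΩ hy hg hb hβ hbβ).space_mul_time (memLp_mul_top hy hb') hm hw

end Slices

/-! ### Derivatives of the Goh transform -/

section Goh

variable {n m : ℕ} {Ω : Set (Sp n)} {T : ℝ} {ζ z y : Y Ω T} {b : Fin m → W2Inf Ω}
  {v : Fin m → ℝ → ℝ}

theorem Y.memLp_val (y : Y Ω T) : MemLp y.val 2 (measQ Ω T) := Lp.memLp _
theorem Y.memLp_dt (y : Y Ω T) : MemLp y.dt 2 (measQ Ω T) := Lp.memLp _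
theorem Y.memLp_grad (y : Y Ω T) (l : Fin n) : MemLp (y.grad l) 2 (measQ Ω T) := Lp.memLp _

/-- The two product rules in time give a square integrable weak derivative of the right-hand side;
uniqueness identifies it with the recorded ζ̇. -/
theorem goh_dt (hΩ : IsOpen Ω) (hT : 0 < T) {Z : ℝ → L2Omega Ω} (hZ : y.IsTimeRep Z)
    (hv : ∀ i, MemLp (v i) 2 (measT T))
    (hζ : ∀ᵐ p ∂(measQ Ω T), ζ.val p = z.val p -
      ∑ i, y.val p * (b i).val p.1 * ∫ s in (0 : ℝ)..p.2, v i s) :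
    ∀ᵐ p ∂(measQ Ω T), ζ.dt p = z.dt p - ∑ i, (y.dt p * (b i).val p.1 *
      (∫ s in (0 : ℝ)..p.2, v i s) + y.val p * (b i).val p.1 * v i p.2) := by
  have hb := fun i => memLp_top_comp_fst (ν := measT T) (b i).memLp_val
  have hw := fun i => memLp_top_comp_snd (μ := measOmega Ω) (memLp_top_of_continuousOn
    (continuousOn_primitive hT.le (integrableOn_of_memLp_two (hv i))))
  have m1 : ∀ i, MemLp (fun p => y.val p * (b i).val p.1 * ∫ s in (0 : ℝ)..p.2, v i s) 2
      (measQ Ω T) := fun i => memLp_mul_top (memLp_mul_top y.memLp_val (hb i)) (hw i)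
  have m2 : ∀ i, MemLp (fun p => y.dt p * (b i).val p.1 * (∫ s in (0 : ℝ)..p.2, v i s) +
      y.val p * (b i).val p.1 * v i p.2) 2 (measQ Ω T) := fun i => by
    refine (memLp_mul_top (memLp_mul_top y.memLp_dt (hb i)) (hw i)).add ?_
    refine (memLp_mul_top (hZ.memLp_mul_time (hv i)) (hb i)).ae_eq (ae_of_all _ fun p => ?_)
    simp only
    ring
  have d1 : ∀ i, HasWeakDeriv (Ω ×ˢ Ioo 0 T) (measQ Ω T) (0, 1)
      (fun p => y.val p * (b i).val p.1 * ∫ s in (0 : ℝ)..p.2, v i s)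
      (fun p => y.dt p * (b i).val p.1 * (∫ s in (0 : ℝ)..p.2, v i s) +
        y.val p * (b i).val p.1 * v i p.2) := fun i =>
    (HasWeakDeriv.time_mul_space hΩ y.2.2.2.1 y.memLp_val y.memLp_dt
      (b i).memLp_val).time_mul_primitive hT (memLp_mul_top y.memLp_val (hb i))
      (memLp_mul_top y.memLp_dt (hb i)) (hv i)
  have d2 := HasWeakDeriv.sub (V := Sp n × ℝ) (g' := fun p => ∑ i, (y.dt p * (b i).val p.1 *
      (∫ s in (0 : ℝ)..p.2, v i s) + y.val p * (b i).val p.1 * v i p.2))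
    z.2.2.2.1 (HasWeakDeriv.sum Finset.univ (fun i _ => d1 i) (fun i _ => m1 i) fun i _ => m2 i)
    z.memLp_val z.memLp_dt (memLp_finsetSum _ fun i _ => m1 i) (memLp_finsetSum _ fun i _ => m2 i)
  exact HasWeakDeriv.ae_unique (hΩ.prod isOpen_Ioo) (ae_mem_cylinder hΩ)
    (HasWeakDeriv.congr ζ.2.2.2.1 hζ .rfl) d2 ζ.memLp_dt
    (z.memLp_dt.sub (memLp_finsetSum _ fun i _ => m2 i))

theorem goh_grad (hΩ : IsOpen Ω) {w : Fin m → ℝ → ℝ} (hw : ∀ i, MemLp (w i) ∞ (measT T))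
    (hζ : ∀ᵐ p ∂(measQ Ω T), ζ.val p = z.val p - ∑ i, y.val p * (b i).val p.1 * w i p.2)
    (l : Fin n) :
    ∀ᵐ p ∂(measQ Ω T), ζ.grad l p = z.grad l p - ∑ i, (y.grad l p * (b i).val p.1 +
      y.val p * (b i).grad l p.1) * w i p.2 := by
  have hb := fun i => memLp_top_comp_fst (ν := measT T) (b i).memLp_val
  have hβ := fun i => memLp_top_comp_fst (ν := measT T) ((b i).memLp_grad l)
  have hw' := fun i => memLp_top_comp_snd (μ := measOmega Ω) (hw i)
  have m1 : ∀ i, MemLp (fun p => y.val p * (b i).val p.1 * w i p.2) 2 (measQ Ω T) :=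
    fun i => memLp_mul_top (memLp_mul_top y.memLp_val (hb i)) (hw' i)
  have m2 : ∀ i, MemLp (fun p => (y.grad l p * (b i).val p.1 + y.val p * (b i).grad l p.1) *
      w i p.2) 2 (measQ Ω T) := fun i =>
    memLp_mul_top ((memLp_mul_top (y.memLp_grad l) (hb i)).add
      (memLp_mul_top y.memLp_val (hβ i))) (hw' i)
  have d1 := fun i => HasWeakDeriv.space_mul_mul hΩ (y.2.1 l) y.memLp_val (y.memLp_grad l)
    (b i).memLp_val ((b i).memLp_grad l) ((b i).weak_grad l) (hw i)
  have d2 := HasWeakDeriv.sub (V := Sp n × ℝ) (g' := fun p => ∑ i, (y.grad l p * (b i).val p.1 +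
      y.val p * (b i).grad l p.1) * w i p.2)
    (z.2.1 l) (HasWeakDeriv.sum Finset.univ (fun i _ => d1 i) (fun i _ => m1 i) fun i _ => m2 i)
    z.memLp_val (z.memLp_grad l) (memLp_finsetSum _ fun i _ => m1 i)
    (memLp_finsetSum _ fun i _ => m2 i)
  exact HasWeakDeriv.ae_unique (hΩ.prod isOpen_Ioo) (ae_mem_cylinder hΩ)
    (HasWeakDeriv.congr (ζ.2.1 l) hζ .rfl) d2 (ζ.memLp_grad l)
    ((z.memLp_grad l).sub (memLp_finsetSum _ fun i _ => m2 i))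

/-- The gradient formula is split into the parts containing b and ∇b, and the product rule is
applied to each. Only the pure second derivatives enter the Laplacian. -/
theorem goh_hess (hΩ : IsOpen Ω) {w : Fin m → ℝ → ℝ} (hw : ∀ i, MemLp (w i) ∞ (measT T))
    (hζ : ∀ᵐ p ∂(measQ Ω T), ζ.val p = z.val p - ∑ i, y.val p * (b i).val p.1 * w i p.2)
    (l : Fin n) :
    ∀ᵐ p ∂(measQ Ω T), ζ.1.2.2.1 l l p = z.1.2.2.1 l l p -
      ∑ i, ((y.1.2.2.1 l l p * (b i).val p.1 + y.grad l p * (b i).grad l p.1) * w i p.2 +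
        (y.grad l p * (b i).grad l p.1 + y.val p * (b i).hess l l p.1) * w i p.2) := by
  have hb := fun i => memLp_top_comp_fst (ν := measT T) (b i).memLp_val
  have hβ := fun i => memLp_top_comp_fst (ν := measT T) ((b i).memLp_grad l)
  have hh := fun i => memLp_top_comp_fst (ν := measT T) ((b i).memLp_hess l l)
  have hw' := fun i => memLp_top_comp_snd (μ := measOmega Ω) (hw i)
  have my : MemLp (y.1.2.2.1 l l) 2 (measQ Ω T) := Lp.memLp _
  have ma : ∀ i, MemLp (fun p => y.grad l p * (b i).val p.1 * w i p.2) 2 (measQ Ω T) := fun i =>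
    memLp_mul_top (memLp_mul_top (y.memLp_grad l) (hb i)) (hw' i)
  have mb : ∀ i, MemLp (fun p => y.val p * (b i).grad l p.1 * w i p.2) 2 (measQ Ω T) := fun i =>
    memLp_mul_top (memLp_mul_top y.memLp_val (hβ i)) (hw' i)
  have mc : ∀ i, MemLp (fun p => (y.1.2.2.1 l l p * (b i).val p.1 +
      y.grad l p * (b i).grad l p.1) * w i p.2) 2 (measQ Ω T) := fun i =>
    memLp_mul_top ((memLp_mul_top my (hb i)).add
      (memLp_mul_top (y.memLp_grad l) (hβ i))) (hw' i)
  have md : ∀ i, MemLp (fun p => (y.grad l p * (b i).grad l p.1 +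
      y.val p * (b i).hess l l p.1) * w i p.2) 2 (measQ Ω T) := fun i =>
    memLp_mul_top ((memLp_mul_top (y.memLp_grad l) (hβ i)).add
      (memLp_mul_top y.memLp_val (hh i))) (hw' i)
  have da := fun i => HasWeakDeriv.space_mul_mul hΩ (y.2.2.1 l l) (y.memLp_grad l) my
    (b i).memLp_val ((b i).memLp_grad l) ((b i).weak_grad l) (hw i)
  have db := fun i => HasWeakDeriv.space_mul_mul hΩ (y.2.1 l) y.memLp_val (y.memLp_grad l)
    ((b i).memLp_grad l) ((b i).memLp_hess l l) ((b i).weak_hess l l) (hw i)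
  have d1 := fun i => HasWeakDeriv.add (da i) (db i) (ma i) (mc i) (mb i) (md i)
  have mz : MemLp (z.1.2.2.1 l l) 2 (measQ Ω T) := Lp.memLp _
  have d2 := HasWeakDeriv.sub (V := Sp n × ℝ) (z.2.2.1 l l)
    (HasWeakDeriv.sum Finset.univ (fun i _ => d1 i) (fun i _ => (ma i).add (mb i))
      fun i _ => (mc i).add (md i))
    (z.memLp_grad l) mz (memLp_finsetSum _ fun i _ => (ma i).add (mb i))
    (memLp_finsetSum _ fun i _ => (mc i).add (md i))
  have hg : ζ.grad l =ᵐ[measQ Ω T] fun p => z.grad l p - ∑ i, (y.grad l p * (b i).val p.1 *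
      w i p.2 + y.val p * (b i).grad l p.1 * w i p.2) := by
    filter_upwards [goh_grad hΩ hw hζ l] with p hp
    rw [hp]
    simp_rw [add_mul]
  exact HasWeakDeriv.ae_unique (hΩ.prod isOpen_Ioo) (ae_mem_cylinder hΩ)
    (HasWeakDeriv.congr (ζ.2.2.1 l l) hg .rfl) d2 (Lp.memLp _)
    (mz.sub (memLp_finsetSum _ fun i _ => (mc i).add (md i)))

end Goh

/-! ### The transformed state equation. -/

namespace Problem.Trajectory

variable {n m q : ℕ} {P : Problem n m q} (tr : P.Trajectory)

/-- The Goh transform of a solution of the linearized state equation solves the transformed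
equation. -/
theorem goh_equation {ζ z : Y P.Ω P.T} {v w : Fin m → L2T P.T}
    (hz : ∀ᵐ p ∂(measQ P.Ω P.T),
      z.dt p + tr.opA z p = ∑ i, v i p.2 * (P.b i.succ).val p.1 * tr.y.val p)
    (hw : ∀ i, ∀ᵐ t ∂(measT P.T), w i t = ∫ s in (0 : ℝ)..t, v i s)
    (hζ : ∀ᵐ p ∂(measQ P.Ω P.T),
      ζ.val p = z.val p - ∑ i, tr.y.val p * (P.b i.succ).val p.1 * w i p.2) :
    ∀ᵐ p ∂(measQ P.Ω P.T), ζ.dt p + tr.opA ζ p = ∑ i, tr.B1 i p * w i p.2 := by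
  have hv : ∀ i, MemLp (v i) 2 (measT P.T) := fun i => Lp.memLp _
  have hwQ := ae_measQ_of_ae_snd (Ω := P.Ω) (ae_all_iff.2 hw)
  have hζ' : ∀ᵐ p ∂(measQ P.Ω P.T), ζ.val p = z.val p -
      ∑ i, tr.y.val p * (P.b i.succ).val p.1 * ∫ s in (0 : ℝ)..p.2, v i s := by
    filter_upwards [hζ, hwQ] with p h1 h2
    rw [h1]
    simp_rw [h2]
  have hW : ∀ i, MemLp (fun t => ∫ s in (0 : ℝ)..t, v i s) ∞ (measT P.T) := fun i =>
    memLp_top_of_continuousOn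
      (continuousOn_primitive P.T_pos.le (integrableOn_of_memLp_two (hv i)))
  filter_upwards [hz, hwQ, hζ', tr.state_eq,
    goh_dt P.isOpen_Ω P.T_pos tr.isTimeRep hv (b := fun i => P.b i.succ) hζ',
    ae_all_iff.2 (goh_hess P.isOpen_Ω hW (b := fun i => P.b i.succ) hζ')] with p e1 e2 e3 e4 e5 e6
  have hl : ζ.lap p = z.lap p - ∑ i, (tr.y.lap p * (P.b i.succ).val p.1 +
      2 * ∑ l, tr.y.grad l p * (P.b i.succ).grad l p.1 +
      tr.y.val p * ∑ l, (P.b i.succ).hess l l p.1) * ∫ s in (0 : ℝ)..p.2, v i s := by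
    simp only [Y.lap, e6, Finset.sum_sub_distrib]
    rw [Finset.sum_comm]
    congr 1
    refine Finset.sum_congr rfl fun i _ => ?_
    simp only [Finset.sum_mul, Finset.mul_sum, ← Finset.sum_add_distrib]
    exact Finset.sum_congr rfl fun l _ => by ring
  simp only [opA] at e1 ⊢
  have e7 : z.dt p = ∑ i, v i p.2 * (P.b i.succ).val p.1 * tr.y.val p -
      (-z.lap p + 3 * P.γ * tr.y.val p ^ 2 * z.val p - P.potential tr.u p * z.val p) := by
    linarith
  rw [e5, hl, e3, e7]
  -- Here S, D and L collect the contributions of ȳ Σ b_i w_i to ζ, ζ̇ and Δζ. The isolated last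
  -- bracket, containing all terms in z, cancels.
  have split : ∀ (a s S D L R : ℝ), s - a - D + (-(R - L) + 3 * P.γ * tr.y.val p ^ 2 * (z.val p - S)
      - P.potential tr.u p * (z.val p - S)) = s - D + L
      - (3 * P.γ * tr.y.val p ^ 2 - P.potential tr.u p) * S +
      (-R + 3 * P.γ * tr.y.val p ^ 2 * z.val p - P.potential tr.u p * z.val p - a) :=
    fun _ _ _ _ _ _ => by ring
  rw [split, sub_self, add_zero, Finset.mul_sum, ← Finset.sum_sub_distrib,
    ← Finset.sum_add_distrib, ← Finset.sum_sub_distrib]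
  refine Finset.sum_congr rfl fun i _ => ?_
  rw [e2, B1]
  -- The terms in v_i have cancelled. The state equation times −b_i w_i removes ȳ̇, Δȳ and the
  -- potential; the cubic terms combine to −3γ + γ = −2γ.
  linear_combination (-(P.b i.succ).val p.1 * ∫ s in (0 : ℝ)..p.2, v i s) * e4

end Problem.Trajectory

/-! ### Bounded multiplication and tensor product as continuous operators on L². -/

section Operators

variable {α β : Type*} [MeasurableSpace α] [MeasurableSpace β]

/-- Multiplication by a bounded function on `L²`. -/
def mulL {μ : Measure α} {b : α → ℝ} (hb : MemLp b ∞ μ) : Lp ℝ 2 μ →L[ℝ] Lp ℝ 2 μ :=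
  (ContinuousLinearMap.mul ℝ ℝ).holderL μ ∞ 2 2 (hb.toLp b)

theorem coeFn_mulL {μ : Measure α} {b : α → ℝ} (hb : MemLp b ∞ μ) (f : Lp ℝ 2 μ) :
    mulL hb f =ᵐ[μ] fun x => b x * f x := by
  have h := (ContinuousLinearMap.mul ℝ ℝ).coeFn_holder (r := 2) (hb.toLp b) f
  filter_upwards [h, hb.coeFn_toLp] with x h1 h2
  rw [mulL, ContinuousLinearMap.holderL_apply_apply, h1, ContinuousLinearMap.mul_apply', h2]

theorem inner_eq_integral {μ : Measure α} (f g : Lp ℝ 2 μ) :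
    inner ℝ f g = ∫ x, f x * g x ∂μ := by
  rw [L2.inner_def]
  refine integral_congr_ae (ae_of_all _ fun x => ?_)
  simp [mul_comm]

theorem inner_toLp_eq_integral {μ : Measure α} {f : α → ℝ} (hf : MemLp f 2 μ) (g : Lp ℝ 2 μ) :
    inner ℝ (hf.toLp f) g = ∫ x, f x * g x ∂μ := by
  rw [inner_eq_integral]
  refine integral_congr_ae ?_
  filter_upwards [hf.coeFn_toLp] with x hx
  rw [hx]

/-- The tensor product of two square integrable functions. -/
def tensorL (μ : Measure α) (ν : Measure β) [SFinite μ] [SFinite ν] :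
    Lp ℝ 2 μ →L[ℝ] Lp ℝ 2 ν →L[ℝ] Lp ℝ 2 (μ.prod ν) :=
  LinearMap.mkContinuous₂
    (LinearMap.mk₂ ℝ (fun f g => (memLp_tensor (Lp.memLp f) (Lp.memLp g)).toLp _)
      (fun f f' g => by
        rw [← MemLp.toLp_add]
        refine MemLp.toLp_congr _ _ ?_
        filter_upwards [Measure.quasiMeasurePreserving_fst.ae (Lp.coeFn_add f f')] with p hp
        simp only [Pi.add_apply] at hp ⊢
        rw [hp, add_mul])
      (fun c f g => by
        rw [← MemLp.toLp_const_smul]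
        refine MemLp.toLp_congr _ _ ?_
        filter_upwards [Measure.quasiMeasurePreserving_fst.ae (Lp.coeFn_smul c f)] with p hp
        simp only [Pi.smul_apply, smul_eq_mul] at hp ⊢
        rw [hp, mul_assoc])
      (fun f g g' => by
        rw [← MemLp.toLp_add]
        refine MemLp.toLp_congr _ _ ?_
        filter_upwards [Measure.quasiMeasurePreserving_snd.ae (Lp.coeFn_add g g')] with p hp
        simp only [Pi.add_apply] at hp ⊢
        rw [hp, mul_add])
      (fun c f g => by
        rw [← MemLp.toLp_const_smul]
        refine MemLp.toLp_congr _ _ ?_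
        filter_upwards [Measure.quasiMeasurePreserving_snd.ae (Lp.coeFn_smul c g)] with p hp
        simp only [Pi.smul_apply, smul_eq_mul] at hp ⊢
        rw [hp, mul_left_comm]))
    1 (fun f g => by
      rw [one_mul, LinearMap.mk₂_apply, Lp.norm_toLp, eLpNorm_tensor (Lp.memLp f).1 (Lp.memLp g).1,
        ENNReal.toReal_mul, Lp.norm_def, Lp.norm_def])

theorem coeFn_tensorL {μ : Measure α} {ν : Measure β} [SFinite μ] [SFinite ν]
    (f : Lp ℝ 2 μ) (g : Lp ℝ 2 ν) :
    tensorL μ ν f g =ᵐ[μ.prod ν] fun p => f p.1 * g p.2 :=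
  (memLp_tensor (Lp.memLp f) (Lp.memLp g)).coeFn_toLp

end Operators

/-! ### The primitive in time as a bounded operator, and time representatives. -/

section Primitive

variable {n : ℕ} {Ω : Set (Sp n)} {T : ℝ}

/-- The indicator function of `(0,t)` in `L²(0,T)`. -/
def indT (T t : ℝ) : L2T T :=
  indicatorConstLp 2 (measurableSet_Iio (a := t)) (measure_ne_top (measT T) _) (1 : ℝ)

/-- The half-lines ending at s and t differ by a set of measure at most |s − t|. Continuity of
`primL` in time comes from here. -/
theorem continuous_indT : Continuous (indT T) := by
  refine continuous_indicatorConstLp_set (by simp) fun t => ?_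
  have hle : ∀ s, measT T (symmDiff (Iio s) (Iio t)) ≤ ENNReal.ofReal |s - t| := fun s => by
    refine (Measure.restrict_apply_le _ _).trans ?_
    refine (measure_mono (t := Ico (min s t) (max s t)) ?_).trans_eq ?_
    · rintro x (⟨h1, h2⟩ | ⟨h1, h2⟩)
      · exact ⟨(min_le_right _ _).trans (not_lt.1 h2), lt_max_of_lt_left h1⟩
      · exact ⟨(min_le_left _ _).trans (not_lt.1 h2), lt_max_of_lt_right h1⟩
    · rw [Real.volume_Ico, max_sub_min_eq_abs']
  refine tendsto_of_tendsto_of_tendsto_of_le_of_le tendsto_const_nhds ?_ (fun _ => zero_le) hle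
  have : Continuous fun s : ℝ => ENNReal.ofReal |s - t| :=
    ENNReal.continuous_ofReal.comp (by fun_prop)
  simpa using this.tendsto t

/-- The operator `g ↦ ∫_0^t g(·,s) ds` from `L²(Q)` to `L²(Ω)`. -/
def primL (Ω : Set (Sp n)) (T t : ℝ) : L2Q Ω T →L[ℝ] L2Omega Ω :=
  ((tensorL (measOmega Ω) (measT T)).flip (indT T t)).adjoint

theorem continuous_primL (g : L2Q Ω T) : Continuous fun t => primL Ω T t g := by
  have : Continuous fun t => primL Ω T t :=
    (ContinuousLinearMap.adjoint (𝕜 := ℝ) (E := L2Omega Ω) (F := L2Q Ω T)).continuous.comp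
      ((tensorL (measOmega Ω) (measT T)).flip.continuous.comp continuous_indT)
  exact this.clm_apply continuous_const

/-- The adjoint moves the operator onto ψ ⊗ 1_(0,t), and Fubini turns the pairing over Q into an
iterated integral. -/
theorem inner_primL {t : ℝ} (ht : t ∈ Icc 0 T) (ψ : L2Omega Ω) (g : L2Q Ω T) :
    inner ℝ ψ (primL Ω T t g) =
      ∫ s in (0 : ℝ)..t, ∫ x, ψ x * g (x, s) ∂(measOmega Ω) := by
  rw [primL, ContinuousLinearMap.adjoint_inner_right, inner_eq_integral,
    ContinuousLinearMap.flip_apply]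
  have hi := L2.integrable_inner (𝕜 := ℝ) g (tensorL (measOmega Ω) (measT T) ψ (indT T t))
  simp only [RCLike.inner_apply, conj_trivial] at hi
  rw [integral_prod_symm _ hi, intervalIntegral.integral_of_le ht.1, integral_Ioc_eq_integral_Ioo]
  have e : ∫ s in Ioo 0 t, ∫ x, ψ x * g (x, s) ∂(measOmega Ω) = ∫ s, (Iio t).indicator
      (fun s => ∫ x, ψ x * g (x, s) ∂(measOmega Ω)) s ∂(measT T) := by
    rw [integral_indicator measurableSet_Iio, measT, Measure.restrict_restrict measurableSet_Iio]
    congr 2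
    ext s
    exact ⟨fun h => ⟨h.2, h.1, h.2.trans_le ht.2⟩, fun h => ⟨h.2.1, h.1⟩⟩
  rw [e]
  refine integral_congr_ae ?_
  filter_upwards [ae_ae_of_ae_measQ (coeFn_tensorL ψ (indT T t)),
    indicatorConstLp_coeFn (μ := measT T) (p := 2) (hs := measurableSet_Iio (a := t))
      (hμs := measure_ne_top (measT T) _) (c := (1 : ℝ))] with s h1 h2
  have : ∀ᵐ x ∂(measOmega Ω), tensorL (measOmega Ω) (measT T) ψ (indT T t) (x, s) * g (x, s) =
      (Iio t).indicator (fun _ => ψ x * g (x, s)) s := by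
    filter_upwards [h1] with x hx
    rw [hx, indT, h2]
    by_cases hs : s ∈ Iio t <;> simp [hs]
  rw [integral_congr_ae this]
  by_cases hs : s ∈ Iio t <;> simp [hs]

theorem primL_zero (hT : 0 ≤ T) (g : L2Q Ω T) : primL Ω T 0 g = 0 := by
  refine ext_inner_left ℝ fun ψ => ?_
  rw [inner_primL ⟨le_rfl, hT⟩]
  simp

/-- Test functions are dense in `L²(Ω)`. -/
theorem eq_zero_of_forall_isTest (hΩ : IsOpen Ω) {f : L2Omega Ω}
    (h : ∀ ψ, IsTest Ω ψ → ∫ x, ψ x * f x ∂(measOmega Ω) = 0) : f = 0 := by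
  refine (Lp.eq_zero_iff_ae_eq_zero).2 ?_
  exact ae_eq_zero_of_integral_isTest hΩ (ae_restrict_mem hΩ.measurableSet)
    ((Lp.memLp f).locallyIntegrable (by norm_num)) h

/-- Junction times are end points of arcs: information available a.e. on an open arc reaches them
only through continuity. -/
theorem eqOn_Icc_of_ae_eq_Ioo {X : Type*} [TopologicalSpace X] [T2Space X] {a b : ℝ} (hab : a < b)
    {f g : ℝ → X} (h : ∀ᵐ t ∂(volume.restrict (Ioo a b)), f t = g t)
    (hf : ContinuousOn f (Icc a b)) (hg : ContinuousOn g (Icc a b)) : EqOn f g (Icc a b) := by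
  rw [Measure.restrict_congr_set Ioo_ae_eq_Icc] at h
  exact Measure.eqOn_Icc_of_ae_eq volume hab.ne h hf hg

/-- The continuous representative of an element of `Y` which vanishes at `t = 0` is the primitive
of its time derivative. -/
theorem Y.IsTimeRep.eq_primL (hΩ : IsOpen Ω) (hT : 0 < T) {y : Y Ω T} {Z : ℝ → L2Omega Ω}
    (hZ : y.IsTimeRep Z) (h0 : Z 0 = 0) {t : ℝ} (ht : t ∈ Icc 0 T) :
    Z t = primL Ω T t y.dt := by
  rw [← sub_eq_zero]
  refine eq_zero_of_forall_isTest hΩ fun ψ hψ => ?_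
  have hψ2 := hψ.memLp (μ := measOmega Ω) 2
  rw [← inner_toLp_eq_integral hψ2]
  set ψ' := hψ2.toLp ψ with hψ'
  let h : ℝ → ℝ := fun s => inner ℝ ψ' (Z s - primL Ω T s y.dt)
  have hc : ContinuousOn h (Icc 0 T) :=
    (innerSL ℝ ψ').continuous.comp_continuousOn
      (hZ.1.sub (continuous_primL y.dt).continuousOn)
  have hi : IntegrableOn h (Ioo 0 T) := hc.integrableOn_Icc.mono_set Ioo_subset_Icc_self
  let κ : ℝ → ℝ := fun s => ∫ x, ψ' x * y.dt (x, s) ∂(measOmega Ω)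
  -- `κ` is integrable
  have hone : MemLp (fun _ : ℝ => (1 : ℝ)) 2 (measT T) := memLp_const 1
  have hκ : IntegrableOn κ (Ioo 0 T) := by
    have := (integrable_mul_of_memLp (memLp_tensor (Lp.memLp ψ') hone)
      y.memLp_dt).integral_prod_right
    refine this.congr (ae_of_all _ fun s => ?_)
    simp [κ]
  -- The pairings of ψ with Z and with the primitive of ẏ have the same weak derivative κ: for Z by
  -- testing with ψ ⊗ η, for the primitive by integration by parts. Their difference is thus
  -- constant, and it vanishes at t = 0.
  have key : ∀ η, IsTest (Ioo 0 T) η → ∫ s in Ioo 0 T, h s * deriv η s = 0 := by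
    intro η hη
    have hd : Continuous (deriv η) := hη.1.continuous_deriv (by simp)
    have hdb : ∃ C, ∀ s, ‖deriv η s‖ ≤ C := hη.2.1.deriv.exists_bound_of_continuous hd
    have hdm : MemLp (deriv η) 2 (measT T) := hd.memLp_of_hasCompactSupport hη.2.1.deriv
    obtain ⟨C, hC⟩ := hdb
    have hdi : IntegrableOn (deriv η) (Ioo 0 T) :=
      memLp_one_iff_integrable.1 (hd.memLp_of_hasCompactSupport hη.2.1.deriv)
    have hη0 : ∀ s, s ∉ Ioo 0 T → η s = 0 := fun s hs =>
      image_eq_zero_of_notMem_tsupport fun h' => hs (hη.2.2 h')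
    have i1 : IntegrableOn (fun s => inner ℝ ψ' (Z s) * deriv η s) (Ioo 0 T) :=
      (((innerSL ℝ ψ').continuous.comp_continuousOn hZ.1).integrableOn_Icc.mono_set
        Ioo_subset_Icc_self).mul_bdd hd.aestronglyMeasurable (ae_of_all _ hC)
    have i2 : IntegrableOn (fun s => inner ℝ ψ' (primL Ω T s y.dt) * deriv η s) (Ioo 0 T) :=
      (((innerSL ℝ ψ').continuous.comp_continuousOn
        (continuous_primL y.dt).continuousOn).integrableOn_Icc.mono_set
        Ioo_subset_Icc_self).mul_bdd hd.aestronglyMeasurable (ae_of_all _ hC)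
    have e1 : ∫ s in Ioo 0 T, inner ℝ ψ' (Z s) * deriv η s =
        - ∫ s in Ioo 0 T, κ s * η s := by
      have hw : ∫ p, y.val p * _ ∂(measQ Ω T) = - ∫ p, y.dt p * _ ∂(measQ Ω T) :=
        y.2.2.2.1 _ (hψ.prod hη)
      have hfd : ∀ p : Sp n × ℝ, fderiv ℝ (fun p : Sp n × ℝ => ψ p.1 * η p.2) p (0, 1) =
          ψ p.1 * deriv η p.2 := fun p => by
        have d1 : DifferentiableAt ℝ (fun p : Sp n × ℝ => ψ p.1) p :=
          (hψ.differentiable p.1).comp p differentiableAt_fst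
        have d2 : DifferentiableAt ℝ (fun p : Sp n × ℝ => η p.2) p :=
          (hη.differentiable p.2).comp p differentiableAt_snd
        rw [fderiv_fun_mul d1 d2]
        simp only [add_apply, smul_apply, smul_eq_mul]
        rw [fderiv_comp_fst p (hψ.differentiable p.1), fderiv_comp_snd p (hη.differentiable p.2),
          map_zero, mul_zero, add_zero, fderiv_apply_one_eq_deriv]
      simp_rw [hfd] at hw
      rw [integral_prod_symm _ (integrable_mul_of_memLp y.memLp_val (memLp_tensor hψ2 hdm)),
        integral_prod_symm _ (integrable_mul_of_memLp y.memLp_dt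
          (memLp_tensor hψ2 (hη.memLp 2)))] at hw
      have a1 : ∫ s in Ioo 0 T, inner ℝ ψ' (Z s) * deriv η s =
          ∫ s in Ioo 0 T, ∫ x, y.val (x, s) * (ψ x * deriv η s) ∂(measOmega Ω) := by
        refine integral_congr_ae ?_
        filter_upwards [hZ.2] with s hs
        rw [hψ', inner_toLp_eq_integral, ← integral_mul_const]
        refine integral_congr_ae ?_
        filter_upwards [hs] with x hx
        rw [← hx]
        ring
      have a2 : ∫ s in Ioo 0 T, κ s * η s =
          ∫ s in Ioo 0 T, ∫ x, y.dt (x, s) * (ψ x * η s) ∂(measOmega Ω) := by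
        refine integral_congr_ae (ae_of_all _ fun s => ?_)
        simp only [κ]
        rw [← integral_mul_const]
        refine integral_congr_ae ?_
        filter_upwards [hψ2.coeFn_toLp] with x hx
        rw [hψ', hx]
        ring
      rw [a1, a2]
      exact hw
    have e2 : ∫ s in Ioo 0 T, inner ℝ ψ' (primL Ω T s y.dt) * deriv η s =
        - ∫ s in Ioo 0 T, κ s * η s := by
      have a1 : ∫ s in Ioo 0 T, inner ℝ ψ' (primL Ω T s y.dt) * deriv η s =
          ∫ s in Ioo 0 T, (∫ r in (0 : ℝ)..s, κ r) * deriv η s := by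
        refine setIntegral_congr_fun measurableSet_Ioo fun s hs => ?_
        rw [inner_primL (Ioo_subset_Icc_self hs)]
      rw [a1, integral_primitive_mul hT.le hκ hdi, ← integral_neg]
      refine setIntegral_congr_fun measurableSet_Ioo fun s hs => ?_
      rw [intervalIntegral.integral_deriv_eq_sub (fun x _ => hη.differentiable x)
        (hd.intervalIntegrable _ _), hη0 T (by simp)]
      ring
    have : ∫ s in Ioo 0 T, h s * deriv η s = (∫ s in Ioo 0 T, inner ℝ ψ' (Z s) * deriv η s) -
        ∫ s in Ioo 0 T, inner ℝ ψ' (primL Ω T s y.dt) * deriv η s := by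
      rw [← integral_sub i1 i2]
      refine integral_congr_ae (ae_of_all _ fun s => ?_)
      simp only [h, inner_sub_right]
      ring
    rw [this, e1, e2, sub_self]
  obtain ⟨c, hcst⟩ := exists_ae_eq_const_of_integral_mul_deriv hT hi key
  have heq := eqOn_Icc_of_ae_eq_Ioo hT hcst hc continuousOn_const
  have hz : h 0 = 0 := by simp [h, h0, primL_zero hT.le]
  have h0c : h 0 = c := heq (left_mem_Icc.2 hT.le)
  have htc : h t = c := heq ht
  change h t = 0
  rw [htc, ← h0c, hz]

end Primitive

/-- Convergence in L² implies convergence in measure, hence a.e. along a subsequence. Induction over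
the finite index set makes the subsequence common to all components. -/
theorem exists_subseq_tendsto_ae {ι α : Type*} [Finite ι] [MeasurableSpace α] {μ : Measure α}
    {f : ι → ℕ → Lp ℝ 2 μ} {g : ι → Lp ℝ 2 μ} (h : ∀ i, Tendsto (f i) atTop (𝓝 (g i))) :
    ∃ ns : ℕ → ℕ, StrictMono ns ∧
      ∀ i, ∀ᵐ x ∂μ, Tendsto (fun k => f i (ns k) x) atTop (𝓝 (g i x)) := by
  classical
  have := Fintype.ofFinite ι
  suffices H : ∀ s : Finset ι, ∃ ns : ℕ → ℕ, StrictMono ns ∧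
      ∀ i ∈ s, ∀ᵐ x ∂μ, Tendsto (fun k => f i (ns k) x) atTop (𝓝 (g i x)) by
    obtain ⟨ns, h1, h2⟩ := H Finset.univ
    exact ⟨ns, h1, fun i => h2 i (Finset.mem_univ i)⟩
  intro s
  induction s using Finset.induction_on with
  | empty => exact ⟨id, strictMono_id, by simp⟩
  | insert a s _ ih =>
    obtain ⟨ns, h1, h2⟩ := ih
    obtain ⟨ms, h3, h4⟩ := (tendstoInMeasure_of_tendsto_Lp
      ((h a).comp h1.tendsto_atTop)).exists_seq_tendsto_ae
    refine ⟨ns ∘ ms, h1.comp h3, fun i hi => ?_⟩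
    rcases Finset.mem_insert.1 hi with rfl | hi
    · exact h4
    · filter_upwards [h2 i hi] with x hx
      exact hx.comp h3.tendsto_atTop

/-! ### Continuity of the components of Y and closedness of the primitive representation. -/

section YTop

variable {n : ℕ} {Ω : Set (Sp n)} {T : ℝ}

theorem Y.continuous_val : Continuous (Y.val : Y Ω T → L2Q Ω T) :=
  continuous_fst.comp continuous_subtype_val

theorem Y.continuous_dt : Continuous (Y.dt : Y Ω T → L2Q Ω T) :=
  continuous_snd.comp (continuous_snd.comp (continuous_snd.comp continuous_subtype_val))

theorem Y.continuous_hess (i j : Fin n) : Continuous fun y : Y Ω T => y.1.2.2.1 i j :=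
  (continuous_apply j).comp ((continuous_apply i).comp
    (continuous_fst.comp (continuous_snd.comp (continuous_snd.comp continuous_subtype_val))))

theorem Y.IsTimeRep.eqOn (hT : 0 < T) {y : Y Ω T} {Z Z' : ℝ → L2Omega Ω} (h : y.IsTimeRep Z)
    (h' : y.IsTimeRep Z') : EqOn Z Z' (Icc 0 T) := by
  refine eqOn_Icc_of_ae_eq_Ioo hT ?_ h.1 h'.1
  filter_upwards [h.2, h'.2] with t h1 h2
  exact Lp.ext (h1.symm.trans h2)

/-- The set of elements of `Y` which are the primitive of their time derivative is closed. -/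
theorem Y.isTimeRep_primL_of_tendsto {y : ℕ → Y Ω T} {y' : Y Ω T} (hy : Tendsto y atTop (𝓝 y'))
    (h : ∀ k, (y k).IsTimeRep fun t => primL Ω T t (y k).dt) :
    y'.IsTimeRep fun t => primL Ω T t y'.dt := by
  refine ⟨(continuous_primL _).continuousOn, ?_⟩
  obtain ⟨ns, hns, hv⟩ := exists_subseq_tendsto_ae (ι := Unit)
    (f := fun _ k => (y k).val) (g := fun _ => y'.val)
    fun _ => (Y.continuous_val.tendsto y').comp hy
  have hdt : Tendsto (fun k => (y (ns k)).dt) atTop (𝓝 y'.dt) :=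
    (Y.continuous_dt.tendsto y').comp (hy.comp hns.tendsto_atTop)
  filter_upwards [ae_all_iff.2 fun k => (h (ns k)).2, ae_ae_of_ae_measQ (hv ())] with t h1 h2
  -- This second subsequence may depend on t, which is harmless: the limits are compared on one
  -- slice at a time.
  obtain ⟨ms, hms, h3⟩ := (tendstoInMeasure_of_tendsto_Lp
    (((primL Ω T t).continuous.tendsto y'.dt).comp hdt)).exists_seq_tendsto_ae
  filter_upwards [ae_all_iff.2 h1, h2, h3] with x e1 e2 e3
  refine tendsto_nhds_unique (e2.comp hms.tendsto_atTop) (e3.congr fun k => ?_)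
  exact (e1 (ms k)).symm

end YTop

/-! ### Constraint functionals, arcs, and the kernel relation on `PC`. -/

namespace Problem

variable {n m q : ℕ} (P : Problem n m q)

/-- The functional `y ↦ ∫_Ω c_j(x) y(x) dx`. -/
def cInt (j : Fin q) : L2Omega P.Ω →L[ℝ] ℝ := innerSL ℝ ((P.c j).memLp_val.toLp _)

theorem cInt_apply (j : Fin q) (y : L2Omega P.Ω) :
    P.cInt j y = ∫ x, (P.c j).val x * y x ∂(measOmega P.Ω) :=
  inner_toLp_eq_integral _ _

variable {P}

namespace Trajectory

variable (tr : P.Trajectory) {r : ℕ} {τ : Fin (r + 1) → ℝ}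

theorem M_eq_cInt (t : ℝ) (i : Fin m) (j : Fin q) :
    tr.M t i j = P.cInt j (mulL (P.b i.succ).memLp_val (tr.yt t)) := by
  rw [cInt_apply, M, Matrix.of_apply]
  refine integral_congr_ae ?_
  filter_upwards [coeFn_mulL (P.b i.succ).memLp_val (tr.yt t)] with x hx
  rw [hx]
  ring

theorem continuousOn_M : ContinuousOn tr.M (Icc 0 P.T) := by
  refine continuousOn_pi.2 fun i => continuousOn_pi.2 fun j => ?_
  simp_rw [M_eq_cInt]
  exact ((P.cInt j).continuous.comp (mulL _).continuous).comp_continuousOn tr.isTimeRep.1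

theorem IsArcSubdivision.lt {tr : P.Trajectory} (hτ : tr.IsArcSubdivision τ) (k : Fin r) :
    τ k.castSucc < τ k.succ :=
  hτ.strictMono (Fin.castSucc_lt_succ)

theorem IsArcSubdivision.Icc_subset {tr : P.Trajectory} (hτ : tr.IsArcSubdivision τ) (k : Fin r) :
    Icc (τ k.castSucc) (τ k.succ) ⊆ Icc 0 P.T := by
  rw [← hτ.first, ← hτ.last]
  exact Icc_subset_Icc (hτ.strictMono.monotone (Fin.zero_le _))
    (hτ.strictMono.monotone (Fin.le_last _))

theorem IsArcSubdivision.arc_subset {tr : P.Trajectory} (hτ : tr.IsArcSubdivision τ)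
    (k : Fin r) : arc τ k ⊆ Ioo 0 P.T := by
  rw [← hτ.first, ← hτ.last]
  exact Ioo_subset_Ioo (hτ.strictMono.monotone (Fin.zero_le _))
    (hτ.strictMono.monotone (Fin.le_last _))

theorem IsArcSubdivision.ae_arc {tr : P.Trajectory} (hτ : tr.IsArcSubdivision τ) (k : Fin r)
    {p : ℝ → Prop} (h : ∀ᵐ t ∂(measT P.T), p t) : ∀ᵐ t ∂(volume.restrict (arc τ k)), p t :=
  ae_restrict_of_ae_restrict_of_subset (hτ.arc_subset k) h

/-- Active state constraints are active on the closed arc. -/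
theorem IsArcSubdivision.mem_contactC {tr : P.Trajectory} (hτ : tr.IsArcSubdivision τ)
    {k : Fin r} {j : Fin q} (hj : j ∈ tr.C τ k) {t : ℝ}
    (ht : t ∈ Icc (τ k.castSucc) (τ k.succ)) : t ∈ tr.contactC j := by
  refine ⟨hτ.Icc_subset k ht, ?_⟩
  have hc : ContinuousOn (fun t => P.g j (tr.yt t)) (Icc (τ k.castSucc) (τ k.succ)) := by
    simp only [Problem.g, ← cInt_apply]
    exact ((P.cInt j).continuous.comp_continuousOn
      (tr.isTimeRep.1.mono (hτ.Icc_subset k))).add continuousOn_const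
  refine eqOn_Icc_of_ae_eq_Ioo (hτ.lt k) ?_ hc (continuousOn_const (c := (0 : ℝ))) ht
  filter_upwards [ae_restrict_mem measurableSet_Ioo] with s hs
  have hj' : ∀ t ∈ arc τ k, P.g j (tr.yt t) = 0 := by simpa [C] using hj
  exact hj' s hs

theorem IsArcSubdivision.at_bound {tr : P.Trajectory} {k : Fin r} {i : Fin m}
    (hi : i ∈ tr.B τ k) :
    ∀ᵐ t ∂(volume.restrict (arc τ k)), tr.u i t = P.lo i ∨ tr.u i t = P.hi i := by
  have hi' : (∀ᵐ t ∂(volume.restrict (arc τ k)), tr.u i t = P.lo i) ∨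
      ∀ᵐ t ∂(volume.restrict (arc τ k)), tr.u i t = P.hi i := by simpa [B, Blo, Bhi] using hi
  rcases hi' with h | h
  · filter_upwards [h] with t ht using Or.inl ht
  · filter_upwards [h] with t ht using Or.inr ht

/-- The continuous representative of `ℬ^k w`, expressed by the time derivative `g` of `ζ`. -/
def contB (τ : Fin (r + 1) → ℝ) (k : Fin r) (g : L2Q P.Ω P.T) (w : Fin m → L2T P.T) (t : ℝ) :
    tr.Rows τ k → ℝ :=
  Sum.elim
    (fun i => 1 / (τ k.succ - τ k.castSucc) * ∫ s in (τ k.castSucc)..(τ k.succ), w i.1 s)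
    (fun j => - P.cInt j.1 (primL P.Ω P.T t g))

theorem continuous_contB_time (k : Fin r) (g : L2Q P.Ω P.T) (w : Fin m → L2T P.T) :
    Continuous (tr.contB τ k g w) := by
  refine continuous_pi fun ρ => ?_
  rcases ρ with i | j
  · exact continuous_const
  · exact ((P.cInt j.1).continuous.comp (continuous_primL g)).neg

/-- A mean of w_i is an L² inner product, and the value of ζ at a fixed time is read off from ζ̇
through `primL`. This makes the junction relation a closed condition. -/
theorem continuous_contB {tr : P.Trajectory} (hτ : tr.IsArcSubdivision τ) (k : Fin r) (t : ℝ) :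
    Continuous fun e : Triple P => tr.contB τ k e.1.dt e.2.1 t := by
  refine continuous_pi fun ρ => ?_
  rcases ρ with i | j
  · have h : ∀ w : L2T P.T, ∫ s in (τ k.castSucc)..(τ k.succ), w s =
        inner ℝ (indicatorConstLp 2 (measurableSet_Ioo (a := τ k.castSucc) (b := τ k.succ))
          (measure_ne_top (measT P.T) _) (1 : ℝ)) w := fun w => by
      have hm : (measT P.T).restrict (Ioo (τ k.castSucc) (τ k.succ)) =
          volume.restrict (Ioo (τ k.castSucc) (τ k.succ)) := by
        rw [Measure.restrict_restrict measurableSet_Ioo,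
          inter_eq_left.2 (show Ioo _ _ ⊆ _ from hτ.arc_subset k)]
      rw [L2.inner_indicatorConstLp_one, hm, intervalIntegral.integral_of_le (hτ.lt k).le,
        integral_Ioc_eq_integral_Ioo]
    simp only [contB, Sum.elim_inl, h]
    exact continuous_const.mul (continuous_const.inner
      ((continuous_apply i.1).comp (continuous_fst.comp continuous_snd)))
  · exact ((P.cInt j.1).continuous.comp ((primL P.Ω P.T t).continuous.comp
      (Y.continuous_dt.comp continuous_fst))).neg

/-- Elements of `PC` satisfy the transformed equation, and `𝒜^k w = ℬ^k w` everywhere on the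
closed arcs for the continuous representative of `w`. -/
theorem exists_rep_of_mem_PC {tr : P.Trajectory} (hτ : tr.IsArcSubdivision τ) {e : Triple P}
    (he : e ∈ tr.PC) :
    (∀ᵐ p ∂(measQ P.Ω P.T), e.1.dt p + tr.opA e.1 p = ∑ i, tr.B1 i p * e.2.1 i p.2) ∧
    (e.1.IsTimeRep fun t => primL P.Ω P.T t e.1.dt) ∧
    ∃ W : Fin m → ℝ → ℝ, (∀ i, ∀ᵐ t ∂(measT P.T), e.2.1 i t = W i t) ∧
      ∀ k : Fin r, ∀ t ∈ Icc (τ k.castSucc) (τ k.succ),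
        tr.calA τ k t *ᵥ (fun i => W i t) = tr.contB τ k e.1.dt e.2.1 t := by
  obtain ⟨⟨z, v⟩, ⟨⟨hz, Z, hZ, hZ0⟩, hv0, Z', hZ', hcon⟩, hw, -, hζ⟩ := he
  simp only at hz hZ hv0 hZ' hw hζ
  have hvi : ∀ i, IntegrableOn (v i) (Ioo 0 P.T) := fun i =>
    integrableOn_of_memLp_two (Lp.memLp (v i))
  set W : Fin m → ℝ → ℝ := fun i t => ∫ s in (0 : ℝ)..t, v i s with hW
  have hWc : ∀ i, ContinuousOn (W i) (Icc 0 P.T) := fun i =>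
    continuousOn_primitive P.T_pos.le (hvi i)
  -- Since W and the representatives of z and ȳ are continuous in time, the transform formula itself
  -- yields the continuous representative of ζ.
  let Zζ : ℝ → L2Omega P.Ω := fun t =>
    Z t - ∑ i, W i t • mulL (P.b i.succ).memLp_val (tr.yt t)
  have hrep : e.1.IsTimeRep Zζ := by
    refine ⟨hZ.1.sub (continuousOn_finsetSum _ fun i _ => (hWc i).smul
      ((mulL _).continuous.comp_continuousOn tr.isTimeRep.1)), ?_⟩
    filter_upwards [hZ.2, tr.isTimeRep.2, ae_ae_of_ae_measQ hζ, ae_all_iff.2 hw]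
      with t h1 h2 h3 h4
    have h5 : ∀ᵐ x ∂(measOmega P.Ω), ∀ i,
        (W i t • mulL (P.b i.succ).memLp_val (tr.yt t) : L2Omega P.Ω) x =
          W i t * ((P.b i.succ).val x * tr.yt t x) := ae_all_iff.2 fun i => by
      filter_upwards [Lp.coeFn_smul (W i t) (mulL (P.b i.succ).memLp_val (tr.yt t)),
        coeFn_mulL (P.b i.succ).memLp_val (tr.yt t)] with x e1 e2
      rw [e1, Pi.smul_apply, e2, smul_eq_mul]
    filter_upwards [h1, h2, h3, h5, Lp.coeFn_sub (Z t)
      (∑ i, W i t • mulL (P.b i.succ).memLp_val (tr.yt t)),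
      Lp.coeFn_finsetSum Finset.univ fun i => W i t • mulL (P.b i.succ).memLp_val (tr.yt t)]
      with x e1 e2 e3 e5 e6 e7
    rw [e3, e6, Pi.sub_apply, e7, Finset.sum_apply, e1]
    congr 1
    refine Finset.sum_congr rfl fun i _ => ?_
    rw [e5, h4, e2]
    ring
  have hζ0 : Zζ 0 = 0 := by simp [Zζ, hZ0, hW]
  have hprim : ∀ t ∈ Icc 0 P.T, Zζ t = primL P.Ω P.T t e.1.dt := fun t ht =>
    hrep.eq_primL P.isOpen_Ω P.T_pos hζ0 ht
  refine ⟨tr.goh_equation hz hw hζ, ⟨(continuous_primL _).continuousOn, ?_⟩, W, hw, ?_⟩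
  · filter_upwards [hrep.2, ae_restrict_mem measurableSet_Ioo] with t h1 h2
    rwa [hprim t (Ioo_subset_Icc_self h2)] at h1
  intro k t ht
  have htT := hτ.Icc_subset k ht
  ext ρ
  rcases ρ with ⟨i, hi⟩ | ⟨j, hj⟩
  -- Strict criticality gives v_i = 0 a.e. on the arc, so the primitive is constant up to both ends
  -- and equals its mean.
  · have hconst : ∀ s ∈ Icc (τ k.castSucc) (τ k.succ), W i s = W i t := by
      have hz : ∀ᵐ s ∂(volume.restrict (arc τ k)), v i s = 0 := by
        filter_upwards [hτ.ae_arc k (hv0 i), IsArcSubdivision.at_bound hi] with s h1 h2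
        exact h1 h2
      have hz' : ∀ᵐ s, s ∈ Ioc (τ k.castSucc) (τ k.succ) → v i s = 0 := by
        rw [arc, Measure.restrict_congr_set Ioo_ae_eq_Ioc,
          ae_restrict_iff' measurableSet_Ioc] at hz
        exact hz
      have hc : ∀ s ∈ Icc (τ k.castSucc) (τ k.succ), W i s = W i (τ k.castSucc) := by
        intro s hs
        have hii : ∀ t ∈ Icc 0 P.T, IntervalIntegrable (v i) volume 0 t := fun t ht =>
          (intervalIntegrable_iff_integrableOn_Ioo_of_le ht.1).2
            ((hvi i).mono_set (Ioo_subset_Ioo_right ht.2))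
        rw [← sub_eq_zero, hW]
        simp only
        rw [intervalIntegral.integral_interval_sub_left (hii s (hτ.Icc_subset k hs))
          (hii _ (hτ.Icc_subset k (left_mem_Icc.2 (hτ.lt k).le)))]
        refine intervalIntegral.integral_zero_ae ?_
        filter_upwards [hz'] with x hx hxs
        rw [uIoc_of_le hs.1] at hxs
        exact hx (Ioc_subset_Ioc_right hs.2 hxs)
      exact fun s hs => (hc s hs).trans (hc t ht).symm
    have hmean : ∫ s in (τ k.castSucc)..(τ k.succ), e.2.1 i s =
        (τ k.succ - τ k.castSucc) * W i t := by
      have : ∫ s in (τ k.castSucc)..(τ k.succ), e.2.1 i s =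
          ∫ _ in (τ k.castSucc)..(τ k.succ), W i t := by
        rw [intervalIntegral.integral_of_le (hτ.lt k).le, intervalIntegral.integral_of_le
          (hτ.lt k).le, integral_Ioc_eq_integral_Ioo, integral_Ioc_eq_integral_Ioo]
        refine integral_congr_ae ?_
        filter_upwards [hτ.ae_arc k (hw i), ae_restrict_mem measurableSet_Ioo] with s h1 h2
        rw [h1]
        exact hconst s (Ioo_subset_Icc_self h2)
      rw [this]
      simp
    have hne : τ k.succ - τ k.castSucc ≠ 0 := (sub_pos.2 (hτ.lt k)).ne'
    simp only [contB, Sum.elim_inl, hmean, calA, Matrix.mulVec, Matrix.of_apply]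
    rw [single_one_dotProduct]
    field_simp
  -- The contact set contains the closed arc, end points included, so the z-part of ∫ c_j ζ drops
  -- out.
  · have hz0 : P.cInt j (Z t) = 0 := by
      rw [hZ.eqOn P.T_pos hZ' htT, cInt_apply]
      exact hcon j t (hτ.mem_contactC hj ht)
    simp only [contB, Sum.elim_inr, calA, Matrix.mulVec, Matrix.of_apply, ← hprim t htT, Zζ,
      map_sub, map_sum, map_smul, hz0, zero_sub, neg_neg, dotProduct, M_eq_cInt, smul_eq_mul]
    exact Finset.sum_congr rfl fun i _ => mul_comm _ _

end Trajectory

end Problem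

/-! ### Passage to the closure, continuous coefficients and the junction condition. -/

namespace Problem.Trajectory

variable {n m q : ℕ} {P : Problem n m q} {tr : P.Trajectory} {r : ℕ} {τ : Fin (r + 1) → ℝ}

/-- The properties of `PC` which pass to its closure. -/
theorem spec_of_mem_PC2 (hτ : tr.IsArcSubdivision τ) {e : Triple P} (he : e ∈ tr.PC2) :
    (∀ᵐ p ∂(measQ P.Ω P.T), e.1.dt p + tr.opA e.1 p = ∑ i, tr.B1 i p * e.2.1 i p.2) ∧
    (e.1.IsTimeRep fun t => primL P.Ω P.T t e.1.dt) ∧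
    ∀ k : Fin r, ∀ᵐ t ∂(volume.restrict (arc τ k)),
      tr.calA τ k t *ᵥ (fun i => e.2.1 i t) = tr.contB τ k e.1.dt e.2.1 t := by
  obtain ⟨x, hx, hlim⟩ := mem_closure_iff_seq_limit.1 he
  have hy : Tendsto (fun k => (x k).1) atTop (𝓝 e.1) := (continuous_fst.tendsto e).comp hlim
  have hw : ∀ i, Tendsto (fun k => (x k).2.1 i) atTop (𝓝 (e.2.1 i)) := fun i =>
    (((continuous_apply i).comp (continuous_fst.comp continuous_snd)).tendsto e).comp hlim
  obtain ⟨ns, hns, hwa⟩ := exists_subseq_tendsto_ae hw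
  refine ⟨?_, Y.isTimeRep_primL_of_tendsto hy fun k => (exists_rep_of_mem_PC hτ (hx k)).2.1, ?_⟩
  · have hyn := hy.comp hns.tendsto_atTop
    -- The index runs over ζ, ζ̇ and the pure second derivatives. No boundedness of the coefficients
    -- of A is available, so the limit is taken pointwise a.e. along a common subsequence.
    obtain ⟨ms, hms, hya⟩ := exists_subseq_tendsto_ae (ι := Option (Option (Fin n)))
      (f := fun o k => match o with
        | none => (x (ns k)).1.val
        | some none => (x (ns k)).1.dt
        | some (some l) => (x (ns k)).1.1.2.2.1 l l)
      (g := fun o => match o with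
        | none => e.1.val
        | some none => e.1.dt
        | some (some l) => e.1.1.2.2.1 l l)
      (fun o => match o with
        | none => (Y.continuous_val.tendsto e.1).comp hyn
        | some none => (Y.continuous_dt.tendsto e.1).comp hyn
        | some (some l) => ((Y.continuous_hess l l).tendsto e.1).comp hyn)
    filter_upwards [ae_all_iff.2 fun k => (exists_rep_of_mem_PC hτ (hx (ns (ms k)))).1,
      ae_measQ_of_ae_snd (Ω := P.Ω) (ae_all_iff.2 hwa), ae_all_iff.2 hya] with p h1 h2 h3
    have hv := h3 none
    have hd := h3 (some none)
    have hl : Tendsto (fun k => (x (ns (ms k))).1.lap p) atTop (𝓝 (e.1.lap p)) :=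
      tendsto_finsetSum _ fun l _ => h3 (some (some l))
    have hL : Tendsto (fun k => (x (ns (ms k))).1.dt p + tr.opA (x (ns (ms k))).1 p) atTop
        (𝓝 (e.1.dt p + tr.opA e.1 p)) :=
      hd.add ((hl.neg.add (hv.const_mul _)).sub (hv.const_mul _))
    have hR : Tendsto (fun k => ∑ i, tr.B1 i p * (x (ns (ms k))).2.1 i p.2) atTop
        (𝓝 (∑ i, tr.B1 i p * e.2.1 i p.2)) :=
      tendsto_finsetSum _ fun i _ => ((h2 i).comp hms.tendsto_atTop).const_mul _
    exact tendsto_nhds_unique hL (hR.congr fun k => (h1 k).symm)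
  · intro k
    have hseq : ∀ j, ∀ᵐ t ∂(volume.restrict (arc τ k)),
        tr.calA τ k t *ᵥ (fun i => (x (ns j)).2.1 i t) =
          tr.contB τ k (x (ns j)).1.dt (x (ns j)).2.1 t := fun j => by
      obtain ⟨-, -, W, hW, hA⟩ := exists_rep_of_mem_PC hτ (hx (ns j))
      filter_upwards [hτ.ae_arc k (ae_all_iff.2 hW), ae_restrict_mem measurableSet_Ioo]
        with t h1 h2
      simp_rw [h1]
      exact hA k t (Ioo_subset_Icc_self h2)
    filter_upwards [ae_all_iff.2 hseq, hτ.ae_arc k (ae_all_iff.2 hwa)] with t h1 h2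
    have hL : Tendsto (fun j => tr.calA τ k t *ᵥ (fun i => (x (ns j)).2.1 i t)) atTop
        (𝓝 (tr.calA τ k t *ᵥ (fun i => e.2.1 i t))) :=
      ((continuous_const (y := tr.calA τ k t)).matrix_mulVec continuous_id |>.tendsto _).comp
        (tendsto_pi_nhds.2 h2)
    have hR : Tendsto (fun j => tr.contB τ k (x (ns j)).1.dt (x (ns j)).2.1 t) atTop
        (𝓝 (tr.contB τ k e.1.dt e.2.1 t)) :=
      ((continuous_contB hτ k t).tendsto e).comp (hlim.comp hns.tendsto_atTop)
    exact tendsto_nhds_unique hL (hR.congr fun j => (h1 j).symm)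

theorem transpose_mulVec_dotProduct {ι κ : Type*} [Fintype ι] [Fintype κ] (A : Matrix ι κ ℝ)
    (ν : ι → ℝ) (x : κ → ℝ) : (Aᵀ *ᵥ ν) ⬝ᵥ x = ν ⬝ᵥ (A *ᵥ x) := by
  rw [Matrix.mulVec_transpose, Matrix.dotProduct_mulVec]

/-- The junction relation for the right-hand sides `ℬ^k w`. -/
theorem contB_junction (hτ : tr.IsArcSubdivision τ) {k k' : Fin r}
    (hk : τ k'.castSucc = τ k.succ) {ν : tr.Rows τ k → ℝ} {ν' : tr.Rows τ k' → ℝ}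
    (hν : (tr.calA τ k (τ k.succ))ᵀ *ᵥ ν = (tr.calA τ k' (τ k.succ))ᵀ *ᵥ ν')
    {e : Triple P} (he : e ∈ tr.PC2) :
    ν ⬝ᵥ tr.contB τ k e.1.dt e.2.1 (τ k.succ) = ν' ⬝ᵥ tr.contB τ k' e.1.dt e.2.1 (τ k.succ) := by
  have hcl : IsClosed {e : Triple P | ν ⬝ᵥ tr.contB τ k e.1.dt e.2.1 (τ k.succ) =
      ν' ⬝ᵥ tr.contB τ k' e.1.dt e.2.1 (τ k.succ)} :=
    isClosed_eq (continuous_const.dotProduct (continuous_contB hτ k _))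
      (continuous_const.dotProduct (continuous_contB hτ k' _))
  -- On `PC` the single value W(τ) serves both arcs, so both sides equal c · W(τ).
  refine closure_minimal (fun e he => ?_) hcl he
  obtain ⟨-, -, W, -, hA⟩ := exists_rep_of_mem_PC hτ he
  change ν ⬝ᵥ _ = ν' ⬝ᵥ _
  rw [← hA k _ (right_mem_Icc.2 (hτ.lt k).le),
    ← hA k' _ ⟨hk.le, hk ▸ (hτ.lt k').le⟩, ← transpose_mulVec_dotProduct, hν,
    transpose_mulVec_dotProduct]

theorem IsArcSubdivision.calA_continuousOn (hτ : tr.IsArcSubdivision τ) (k : Fin r) :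
    ContinuousOn (tr.calA τ k) (Icc (τ k.castSucc) (τ k.succ)) := by
  refine continuousOn_pi.2 fun ρ => continuousOn_pi.2 fun i => ?_
  rcases ρ with i' | j
  · exact continuousOn_const
  · exact continuousOn_pi.1 (continuousOn_pi.1 (tr.continuousOn_M.mono (hτ.Icc_subset k)) i) j.1

/-- Under local controllability, `𝒜^k(t)` has independent rows on the closed arc. -/
theorem transpose_calA_injective (hτ : tr.IsArcSubdivision τ) (hctrl : tr.LocallyControllable τ)
    (k : Fin r) {t : ℝ} (ht : t ∈ Icc (τ k.castSucc) (τ k.succ)) {ν : tr.Rows τ k → ℝ}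
    (hν : (tr.calA τ k t)ᵀ *ᵥ ν = 0) : ν = 0 := by
  obtain ⟨α, hα, hle⟩ := hctrl.2
  let μ : {j // j ∈ tr.C τ k} → ℝ := fun j => ν (Sum.inr j)
  have hM := tr.continuousOn_M.mono (hτ.Icc_subset k)
  have hbar : ContinuousOn (fun t => √(∑ i, (tr.Mbar τ k t *ᵥ μ) i ^ 2))
      (Icc (τ k.castSucc) (τ k.succ)) := by
    refine Real.continuous_sqrt.comp_continuousOn (continuousOn_finsetSum _ fun i _ => ?_)
    refine ContinuousOn.pow ?_ 2
    simp only [Matrix.mulVec, dotProduct]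
    refine continuousOn_finsetSum _ fun j _ => ContinuousOn.mul ?_ continuousOn_const
    exact continuousOn_pi.1 (continuousOn_pi.1 hM i.1) j.1
  -- Taking the minimum with 0 encodes the a.e. inequality as an equality of continuous functions,
  -- which extends to the closed arc.
  have hmin : min (√(∑ i, (tr.Mbar τ k t *ᵥ μ) i ^ 2) - α * √(∑ j, μ j ^ 2)) 0 = 0 := by
    refine eqOn_Icc_of_ae_eq_Ioo (hτ.lt k) (f := fun t =>
      min (√(∑ i, (tr.Mbar τ k t *ᵥ μ) i ^ 2) - α * √(∑ j, μ j ^ 2)) 0) (g := fun _ => 0) ?_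
      ((hbar.sub continuousOn_const).inf continuousOn_const) continuousOn_const ht
    filter_upwards [hle k] with s hs
    exact min_eq_right (sub_nonneg.2 (hs μ))
  have hrow : ∀ i, (∑ i' : {i // i ∈ tr.B τ k}, (Pi.single i'.1 (1 : ℝ) : Fin m → ℝ) i *
      ν (Sum.inl i')) + ∑ j, tr.M t i j.1 * μ j = 0 := fun i => by
    have := congrFun hν i
    simpa [Matrix.mulVec, dotProduct, calA, Fintype.sum_sum_type] using this
  -- Rows outside B_k do not meet the unit vectors, so they involve only μ. Once μ = 0, the rows in
  -- B_k give the other components of ν.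
  have hz : tr.Mbar τ k t *ᵥ μ = 0 := by
    ext i
    have h := hrow i.1
    rw [Finset.sum_eq_zero, zero_add] at h
    · exact h
    · intro i' _
      rw [Pi.single_eq_of_ne, zero_mul]
      rintro h'
      exact i.2 (h' ▸ i'.2)
  have hμ : ∀ j, μ j = 0 := by
    rw [hz] at hmin
    have h0 : α * √(∑ j, μ j ^ 2) ≤ 0 := by
      have := min_eq_right_iff.1 hmin
      simpa using this
    have h1 : √(∑ j, μ j ^ 2) ≤ 0 := nonpos_of_mul_nonpos_right h0 hα
    have h2 := Real.sqrt_eq_zero'.1 (le_antisymm h1 (Real.sqrt_nonneg _))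
    have h3 := (Finset.sum_eq_zero_iff_of_nonneg (fun j _ => sq_nonneg (μ j))).1
      (le_antisymm h2 (Finset.sum_nonneg fun j _ => sq_nonneg _))
    exact fun j => pow_eq_zero_iff two_ne_zero |>.1 (h3 j (Finset.mem_univ j))
  ext ρ
  rcases ρ with i | j
  · have h := hrow i.1
    simp only [hμ, mul_zero, Finset.sum_const_zero, add_zero] at h
    rw [Finset.sum_eq_single i] at h
    · simpa using h
    · intro i' _ hne
      rw [Pi.single_eq_of_ne (fun h' => hne (Subtype.ext h'.symm)), zero_mul]
    · simp
  · exact hμ j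

/-- A Gram matrix: 𝒜𝒜ᵀν = 0 forces 𝒜ᵀν = 0, and 𝒜ᵀ is injective. -/
theorem isUnit_det_calA (hτ : tr.IsArcSubdivision τ) (hctrl : tr.LocallyControllable τ)
    (k : Fin r) {t : ℝ} (ht : t ∈ Icc (τ k.castSucc) (τ k.succ)) :
    IsUnit (tr.calA τ k t * (tr.calA τ k t)ᵀ).det := by
  rw [isUnit_iff_ne_zero]
  intro h
  obtain ⟨ν, hν, h0⟩ := Matrix.exists_mulVec_eq_zero_iff.2 h
  rw [← Matrix.conjTranspose_eq_transpose_of_trivial,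
    Matrix.self_mul_conjTranspose_mulVec_eq_zero,
    Matrix.conjTranspose_eq_transpose_of_trivial] at h0
  exact hν (transpose_calA_injective hτ hctrl k ht h0)

/-- On each arc there is a coefficient of `w` which is continuous up to the end points. -/
theorem exists_coeff (hτ : tr.IsArcSubdivision τ) (hctrl : tr.LocallyControllable τ)
    {e : Triple P} (he : e ∈ tr.PC2) (k : Fin r) :
    ∃ lam : ℝ → tr.Rows τ k → ℝ, tr.IsCoeff τ k e.2.1 lam ∧
      ContinuousOn (fun t => (tr.calA τ k t)ᵀ *ᵥ lam t) (Icc (τ k.castSucc) (τ k.succ)) ∧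
      ∀ t ∈ Icc (τ k.castSucc) (τ k.succ),
        tr.calA τ k t *ᵥ ((tr.calA τ k t)ᵀ *ᵥ lam t) = tr.contB τ k e.1.dt e.2.1 t := by
  set G : ℝ → Matrix (tr.Rows τ k) (tr.Rows τ k) ℝ := fun t =>
    tr.calA τ k t * (tr.calA τ k t)ᵀ with hG
  have hA := hτ.calA_continuousOn k
  have hGc : ContinuousOn G (Icc (τ k.castSucc) (τ k.succ)) :=
    (continuous_id.matrix_mul continuous_id.matrix_transpose).comp_continuousOn hA
  have hinv : ContinuousOn (fun t => (G t)⁻¹) (Icc (τ k.castSucc) (τ k.succ)) := by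
    -- The adjugate formula gives continuity of the inverse wherever the determinant does not
    -- vanish.
    simp_rw [Matrix.inv_def, Ring.inverse_eq_inv']
    refine ContinuousOn.smul (ContinuousOn.inv₀
      (continuous_id.matrix_det.comp_continuousOn hGc) fun t ht => ?_)
      (continuous_id.matrix_adjugate.comp_continuousOn hGc)
    exact (isUnit_det_calA hτ hctrl k ht).ne_zero
  have mv : ∀ {κ ι : Type} [Fintype ι] {F : ℝ → Matrix κ ι ℝ} {x : ℝ → ι → ℝ} {s : Set ℝ},
      ContinuousOn F s → ContinuousOn x s → ContinuousOn (fun t => F t *ᵥ x t) s :=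
    fun hF hx => (continuous_fst.matrix_mulVec continuous_snd).comp_continuousOn (hF.prodMk hx)
  have hlam : ContinuousOn (fun t => (G t)⁻¹ *ᵥ tr.contB τ k e.1.dt e.2.1 t)
      (Icc (τ k.castSucc) (τ k.succ)) :=
    mv hinv (tr.continuous_contB_time k _ _).continuousOn
  have heq : ∀ t ∈ Icc (τ k.castSucc) (τ k.succ), tr.calA τ k t *ᵥ ((tr.calA τ k t)ᵀ *ᵥ
      ((G t)⁻¹ *ᵥ tr.contB τ k e.1.dt e.2.1 t)) = tr.contB τ k e.1.dt e.2.1 t := fun t ht => by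
    rw [Matrix.mulVec_mulVec, Matrix.mulVec_mulVec,
      Matrix.mul_nonsing_inv _ (isUnit_det_calA hτ hctrl k ht), Matrix.one_mulVec]
  refine ⟨fun t => (G t)⁻¹ *ᵥ tr.contB τ k e.1.dt e.2.1 t, ⟨hlam.mono Ioo_subset_Icc_self, ?_⟩,
    mv (continuous_id.matrix_transpose.comp_continuousOn hA) hlam, heq⟩
  filter_upwards [(spec_of_mem_PC2 hτ he).2.2 k, ae_restrict_mem measurableSet_Ioo] with t h1 h2
  rw [Matrix.mulVec_sub, h1, heq t (Ioo_subset_Icc_self h2), sub_self]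

/-- Pairing c with a one-sided value gives ν · 𝒜𝒜ᵀλ = ν · ℬ^k w(τ), so only the right-hand sides
matter, and these agree by `contB_junction`. -/
theorem junctionCondition_of_mem_PC2 (hτ : tr.IsArcSubdivision τ)
    (hctrl : tr.LocallyControllable τ) {k k' : Fin r} (hk : (k' : ℕ) = k + 1) {c : Fin m → ℝ}
    (hc : tr.IsJunctionVector τ k k' c) {e : Triple P} (he : e ∈ tr.PC2) :
    tr.JunctionCondition τ k k' c e.2.1 := by
  have hkτ : τ k'.castSucc = τ k.succ := congrArg τ (Fin.ext (by simp [hk]))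
  obtain ⟨⟨ν, hν⟩, ν', hν'⟩ := hc
  obtain ⟨lam, h1, h2, h3⟩ := exists_coeff hτ hctrl he k
  obtain ⟨lam', h1', h2', h3'⟩ := exists_coeff hτ hctrl he k'
  have hr := right_mem_Icc.2 (hτ.lt k).le
  have hl := left_mem_Icc.2 (hτ.lt k').le
  refine ⟨(tr.calA τ k (τ k.succ))ᵀ *ᵥ lam (τ k.succ),
    (tr.calA τ k' (τ k'.castSucc))ᵀ *ᵥ lam' (τ k'.castSucc), ⟨lam, h1, ?_⟩, ⟨lam', h1', ?_⟩, ?_⟩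
  · rw [← nhdsWithin_Ioo_eq_nhdsLT (hτ.lt k)]
    exact (h2 _ hr).mono Ioo_subset_Icc_self
  · rw [← nhdsWithin_Ioo_eq_nhdsGT (hτ.lt k')]
    exact (h2' _ hl).mono Ioo_subset_Icc_self
  · rw [dotProduct_sub, sub_eq_zero]
    have hj := contB_junction hτ hkτ (hν.symm.trans hν') he
    conv_rhs => rw [hν, transpose_mulVec_dotProduct, h3 _ hr, hj]
    rw [hν', ← hkτ, transpose_mulVec_dotProduct, h3' _ hl]

/-- What remains is to replace `contB` by `calB`: for a.e. t the slice ζ(·,t) coincides with the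
primitive of ζ̇. -/
theorem PC2_subset_PC2' (hτ : tr.IsArcSubdivision τ) (hctrl : tr.LocallyControllable τ) :
    tr.PC2 ⊆ tr.PC2' τ := by
  intro e he
  obtain ⟨h1, h2, h3⟩ := spec_of_mem_PC2 hτ he
  refine ⟨⟨h1, _, h2, primL_zero P.T_pos.le _⟩, fun k => ?_,
    fun k k' hk c hc => junctionCondition_of_mem_PC2 hτ hctrl hk hc he⟩
  filter_upwards [h3 k, hτ.ae_arc k h2.2] with t e1 e2
  rw [e1]
  ext ρ
  rcases ρ with i | j
  · rfl
  · simp only [contB, calB, Sum.elim_inr, cInt_apply]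
    congr 1
    refine integral_congr_ae ?_
    filter_upwards [e2] with x hx
    rw [hx]

end Problem.Trajectory

end BilinHeat

end

theorem mainTheorem6 {n m q r : ℕ} (P : BilinHeat.Problem n m q) (tr : P.Trajectory)
    (τ : Fin (r + 1) → ℝ) (hτ : tr.IsArcSubdivision τ) (hctrl : tr.LocallyControllable τ) :
    (∀ k k' : Fin r, (k' : ℕ) = k + 1 → ∀ c : Fin m → ℝ, tr.IsJunctionVector τ k k' c →
      ∀ e ∈ tr.PC2, tr.JunctionCondition τ k k' c e.2.1) ∧
    tr.PC2 ⊆ tr.PC2' τ :=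
  ⟨fun _ _ hk _ hc _ he =>
    BilinHeat.Problem.Trajectory.junctionCondition_of_mem_PC2 hτ hctrl hk hc he,
    BilinHeat.Problem.Trajectory.PC2_subset_PC2' hτ hctrl⟩
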